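/- Let $d\in\mathbb N$, let $\mu$ be a probability measure on $\mathbb R^d$ with compact support that is absolutely continuous with respect to Lebesgue measure, and let $r,q\in[1,\infty)$, $p\in[0,1)$. Let $\sigma:\mathbb R\to\mathbb R$ be a measurable function that is not equal almost everywhere to a polynomial and such that $x\mapsto\sigma(a\cdot x+b)$ belongs to $L^r(\mu)$ for all $a\in\mathbb R^d$, $b\in\mathbb R$ (which is automatic, for example, if $\sigma$ is locally bounded). For $N\in\mathbb N$ consider the one-hidden-layer network with $N$ hidden nodes $$\Psi(x,w)=\sum_{j=1}^N c_j\,\sigma\Big(\sum_{k=1}^d W_{jk}x_k+b_j\Big)+b',\qquad x\in\mathbb R^d,$$ with parameter vector $w=(W,c,b,b')\in\mathbb R^{n}$, $n=Nd+N+N+1$. A random vector $g$ with values in $\{0,1\}^n$ is called * a vector of *dropconnect filters* (with dropout probability $p$) if its components multiplying the weights $W_{jk}$ and $c_j$ are mutually independent and equal to $1$ with probability $1-p$, and its components multiplying the biases $b_j,b'$ are almost surely equal to $1$; * a vector of *node-dropout filters* (with dropout probability $p$, without dropout on the inputs) if there are mutually independent $\{0,1\}$-valued random variables $D_1,\dots,D_N$,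 each equal to $1$ with probability $1-p$, such that almost surely the component of $g$ multiplying $c_j$ equals $D_j$ for every $j$, and the components multiplying the $W_{jk}$, $b_j$ and $b'$ equal $1$. Then for every $\zeta\in L^r(\mu)$ and every $\epsilon>0$ there are $N\in\mathbb N$ and $w\in\mathbb R^{n}$ with output bias $b'=0$ such that, for every vector $g$ of dropconnect filters, defined on any probability space, $$\mathbb P\big[\|\Psi(\cdot,w\odot g)-\zeta\|_{L^r(\mu)}>\epsilon\big]<\epsilon \qquad\text{and}\qquad \mathbb E\big[\|\Psi(\cdot,w\odot g)-\zeta\|_{L^r(\mu)}^q\big]^{1/q}<\epsilon .$$ There are also $N$ and $w$, again with $b'=0$, for which both inequalities hold for every vector $g$ of node-dropout filters. -/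

import Mathlib

open MeasureTheory ProbabilityTheory Matrix
open scoped ENNReal

/-- A layer `x ↦ σ (W x + b)` of a feedforward network, with `σ` applied elementwise. -/
def layer {m n : ℕ} (σ : ℝ → ℝ) (W : Matrix (Fin m) (Fin n) ℝ) (b : Fin m → ℝ)
    (x : Fin n → ℝ) : Fin m → ℝ :=
  fun i => σ ((W *ᵥ x + b) i)

/-- Positions of the entries of the two weight matrices, of sizes `N × d` and `1 × N`, of a
one-hidden-layer network with `d` inputs, `N` hidden nodes and one output. -/
abbrev WeightIdx (d N : ℕ) : Type := (Fin N × Fin d) ⊕ (Fin 1 × Fin N)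

/-- Positions of the entries of the two bias vectors, of sizes `N` and `1`. -/
abbrev BiasIdx (N : ℕ) : Type := Fin N ⊕ Fin 1

/-- Positions of all parameters (weights and biases). -/
abbrev ParamIdx (d N : ℕ) : Type := WeightIdx d N ⊕ BiasIdx N

/-- The one-hidden-layer network `Ψ(x, w) = W⁽²⁾ σ(W⁽¹⁾ x + b⁽¹⁾) + b⁽²⁾`: activation function `σ`
in the hidden layer, identity in the output layer. -/
def network {d N : ℕ} (σ : ℝ → ℝ) (w : ParamIdx d N → ℝ) (x : Fin d → ℝ) : ℝ :=
  layer id (Matrix.of fun i j => w (.inl (.inr (i, j)))) (fun i => w (.inr (.inr i)))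
    (layer σ (Matrix.of fun j k => w (.inl (.inl (j, k)))) (fun j => w (.inr (.inl j))) x) 0

/-- The filtered parameter vector `w ⊙ f`; the filter value `true` stands for `1` and
`false` for `0`. -/
def filtered {ι : Type*} (w : ι → ℝ) (f : ι → Bool) : ι → ℝ :=
  fun i => w i * (if f i then 1 else 0)

/-- Dropconnect filters with dropout probability `p`: the filters of the weights are mutually
independent and equal to `1` with probability `1 - p`; the filters of the biases are equal to `1`
almost surely. -/
structure IsDropconnectFilter {d N : ℕ} {Ω : Type*} [MeasurableSpace Ω] (P : Measure Ω) (p : ℝ)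
    (g : Ω → ParamIdx d N → Bool) : Prop where
  measurable : Measurable g
  prob_weight : ∀ i : WeightIdx d N, P {ω | g ω (.inl i) = true} = ENNReal.ofReal (1 - p)
  indep : iIndepFun (fun (i : WeightIdx d N) ω => g ω (.inl i)) P
  bias_on : ∀ i : BiasIdx N, ∀ᵐ ω ∂P, g ω (.inr i) = true

/-- Node-dropout filters with dropout probability `p₁` on the input nodes and `p₂` on the hidden
nodes: each node `k` carries a variable `D k`, these are mutually independent, the variable of an
input (hidden) node is `1` with probability `1 - p₁` (`1 - p₂`), and the filters of all weights in
the column belonging to that node agree with it almost surely; the filters of the biases are equal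
to `1` almost surely. -/
structure IsNodeDropoutFilter {d N : ℕ} {Ω : Type*} [MeasurableSpace Ω] (P : Measure Ω)
    (p₁ p₂ : ℝ) (g : Ω → ParamIdx d N → Bool) : Prop where
  measurable : Measurable g
  node : ∃ D : Fin d ⊕ Fin N → Ω → Bool,
    (∀ k, Measurable (D k)) ∧ iIndepFun D P ∧
    (∀ k : Fin d, P {ω | D (.inl k) ω = true} = ENNReal.ofReal (1 - p₁)) ∧
    (∀ j : Fin N, P {ω | D (.inr j) ω = true} = ENNReal.ofReal (1 - p₂)) ∧
    (∀ (j : Fin N) (k : Fin d), ∀ᵐ ω ∂P, g ω (.inl (.inl (j, k))) = D (.inl k) ω) ∧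
    (∀ (i : Fin 1) (j : Fin N), ∀ᵐ ω ∂P, g ω (.inl (.inr (i, j))) = D (.inr j) ω)
  bias_on : ∀ i : BiasIdx N, ∀ᵐ ω ∂P, g ω (.inr i) = true

/-- The random function `Y` approximates `ζ` within `ε` in probability, `P[‖Y - ζ‖ > ε] < ε`, and
in `L^q`, `E[‖Y - ζ‖ ^ q] ^ (1 / q) < ε`, for the norm of `L^r(μ)`. -/
def ApproxInProbAndLq {E : Type*} [MeasurableSpace E] (μ : Measure E) (r : ℝ≥0∞) (q ε : ℝ)
    {Ω : Type*} [MeasurableSpace Ω] (P : Measure Ω) (Y : Ω → E → ℝ) (ζ : E → ℝ) : Prop :=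
  P {ω | ENNReal.ofReal ε < eLpNorm (fun x => Y ω x - ζ x) r μ} < ENNReal.ofReal ε ∧
  (∫⁻ ω, eLpNorm (fun x => Y ω x - ζ x) r μ ^ q ∂P) ^ (1 / q) < ENNReal.ofReal ε

/-- Independent Bernoulli variables with given success probabilities exist. -/
theorem exists_indep_bernoulli {ι : Type} [Fintype ι] (s : ι → ℝ)
    (hs : ∀ i, 0 ≤ s i ∧ s i ≤ 1) :
    ∃ P : Measure (ι → Bool), IsProbabilityMeasure P ∧
      iIndepFun (fun i (ω : ι → Bool) => ω i) P ∧
      ∀ i, P {ω | ω i = true} = ENNReal.ofReal (s i) := by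
  classical
  let ν : ι → Measure Bool := fun i =>
    ENNReal.ofReal (s i) • Measure.dirac true + ENNReal.ofReal (1 - s i) • Measure.dirac false
  have hν : ∀ i, IsProbabilityMeasure (ν i) := fun i => ⟨by
    have h := hs i
    simp only [ν, Measure.add_apply, Measure.smul_apply, measure_univ, smul_eq_mul, mul_one]
    rw [← ENNReal.ofReal_add h.1 (by linarith [h.2])]
    simp⟩
  refine ⟨Measure.pi ν, inferInstance, ?_, fun i => ?_⟩
  · exact iIndepFun_pi (X := fun i (b : Bool) => b) (fun i => measurable_id.aemeasurable)
  · have h := (measurePreserving_eval ν i).measure_preimage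
      (s := {true}) (MeasurableSet.singleton true).nullMeasurableSet
    have h2 : (Function.eval i : (ι → Bool) → Bool) ⁻¹' {true} = {ω | ω i = true} := by
      ext ω; simp
    rw [← h2, h]
    simp [ν]

/-- Dropconnect filters exist. -/
theorem exists_isDropconnectFilter (d N : ℕ) (p : ℝ) (hp₀ : 0 ≤ p) (hp₁ : p ≤ 1) :
    ∃ (Ω : Type) (_ : MeasurableSpace Ω) (P : Measure Ω) (g : Ω → ParamIdx d N → Bool),
      IsProbabilityMeasure P ∧ IsDropconnectFilter P p g := by
  obtain ⟨P, hP, hi, hb⟩ := exists_indep_bernoulli (ι := WeightIdx d N) (fun _ => 1 - p)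
    (fun _ => ⟨by linarith, by linarith⟩)
  refine ⟨WeightIdx d N → Bool, inferInstance, P, fun ω => Sum.elim ω (fun _ => true), hP,
    ⟨?_, hb, hi, fun i => by simp⟩⟩
  refine measurable_pi_lambda _ fun i => ?_
  rcases i with i | i
  · exact measurable_pi_apply i
  · exact measurable_const

/-- Node-dropout filters exist. -/
theorem exists_isNodeDropoutFilter (d N : ℕ) (p₁ p₂ : ℝ) (hp₁ : 0 ≤ p₁ ∧ p₁ ≤ 1)
    (hp₂ : 0 ≤ p₂ ∧ p₂ ≤ 1) :
    ∃ (Ω : Type) (_ : MeasurableSpace Ω) (P : Measure Ω) (g : Ω → ParamIdx d N → Bool),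
      IsProbabilityMeasure P ∧ IsNodeDropoutFilter P p₁ p₂ g := by
  obtain ⟨P, hP, hi, hb⟩ := exists_indep_bernoulli (ι := Fin d ⊕ Fin N)
    (Sum.elim (fun _ => 1 - p₁) (fun _ => 1 - p₂))
    (by rintro (i | i) <;> constructor <;> simp <;> linarith [hp₁.1, hp₁.2, hp₂.1, hp₂.2])
  refine ⟨Fin d ⊕ Fin N → Bool, inferInstance, P,
    fun ω => Sum.elim (Sum.elim (fun jk => ω (.inl jk.2)) (fun ij => ω (.inr ij.2)))
      (fun _ => true), hP,
    ⟨?_, ⟨fun k ω => ω k, fun k => measurable_pi_apply k, hi, fun k => hb (.inl k),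
      fun j => hb (.inr j), fun j k => by simp, fun i j => by simp⟩, fun i => by simp⟩⟩
  refine measurable_pi_lambda _ fun i => ?_
  rcases i with (i | i) | i
  · exact measurable_pi_apply (Sum.inl i.2)
  · exact measurable_pi_apply (Sum.inr i.2)
  · exact measurable_const

/-!
The proof separates approximation from randomness.

*Approximation.* The ridge functions `x ↦ σ (a ⬝ᵥ x + b)` span a dense subspace of `L^r(μ)`
(`ridgeSpan_eq_top`). In dimension zero this is trivial. Otherwise, integrability of all translates
of `|σ| ^ r` against one absolutely continuous law forces `σ` to be locally `r`-integrable
(`exists_nhds_setLIntegral_lt_top_of_translates`), so that mollifications `φ ⋆ σ` are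
smooth, and their ridge functions stay in the closed span because they are integrals in `L^r(μ)`
of translated ridge functions (`convolution_mem_ridgeSpan`).
Differentiating `t ↦ (φ ⋆ σ) (t * (a ⬝ᵥ x) + b)` `k` times at `t = 0` in `C(K, ℝ)`, where `K` is the
support of `μ`, gives `(a ⬝ᵥ x) ^ k` times the `k`-th derivative of `φ ⋆ σ` at `b`
(`iteratedDeriv_smul_pow_mem`). For each `k` some such derivative is nonzero, since otherwise `σ`
would be a polynomial almost everywhere (`exists_convolution_iteratedDeriv_ne_zero`). Hence the
closed span contains all powers of linear functionals, so their exponentials, and the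
Stone–Weierstrass theorem applies (`eq_top_of_dotMap_pow_mem`).

*Randomness.* Both kinds of filters treat the hidden nodes alike and pairwise independently
(`IsNodewiseFilter`): a node keeps its outgoing weight and exactly the incoming weights in a set `S`
with a probability `θ S`. Its expected contribution is a multiple of the expected node
`∑ S, θ S * σ (mask S a ⬝ᵥ x + b)`. Expected nodes span all ridge functions, by induction on the
number of nonzero weights (`toLp_mem_span_expectedNode`), because the pattern that keeps everything
has positive probability. So `ζ` is close to a combination of expected nodes, and replacing each
node by `m` copies with outgoing weights divided by `m` makes the random network close to this
combination, by Chebyshev's inequality for the frequencies of the patterns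
(`exists_network_of_expected_combination`). The frequencies are bounded, so the event on which
they are inaccurate contributes little to the moment of order `q`.
-/

/-! ### Small exceptional events, and filters that act nodewise -/

/-- A bounded random quantity that is at most `ε / 2` outside of an event of small enough
probability is small in probability and in `L^q`. The admissible probability `κ` depends
only on `q`, `ε` and the bound `L`. -/
lemma exists_exceptional_prob {q ε L : ℝ} (hq : 1 ≤ q) (hε : 0 < ε) (hL : 0 ≤ L) :
    ∃ κ : ℝ, 0 < κ ∧ ∀ {Ω : Type*} [MeasurableSpace Ω] (P : Measure Ω) [IsProbabilityMeasure P]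
      (X : Ω → ℝ≥0∞) (B : Set Ω), MeasurableSet B → (∀ᵐ ω ∂P, X ω ≤ ENNReal.ofReal L) →
      (∀ᵐ ω ∂P, ω ∉ B → X ω ≤ ENNReal.ofReal (ε / 2)) → P B ≤ ENNReal.ofReal κ →
      P {ω | ENNReal.ofReal ε < X ω} < ENNReal.ofReal ε ∧
      (∫⁻ ω, X ω ^ q ∂P) ^ (1 / q) < ENNReal.ofReal ε := by
  have hq0 : 0 < q := by linarith
  have hgap : 0 < ε ^ q - (ε / 2) ^ q :=
    sub_pos.2 (Real.rpow_lt_rpow (by positivity) (by linarith) hq0)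
  have hLq : 0 ≤ L ^ q := by positivity
  -- the first bound controls the probability, the second one the moment: `L ^ q * κ` has to stay
  -- below the gap `ε ^ q - (ε / 2) ^ q`
  refine ⟨min (ε / 2) ((ε ^ q - (ε / 2) ^ q) / (2 * (L ^ q + 1))),
    lt_min (by linarith) (by positivity), ?_⟩
  intro Ω _ P _ X B hB hXL hXB hPB
  set κ := min (ε / 2) ((ε ^ q - (ε / 2) ^ q) / (2 * (L ^ q + 1))) with hκ
  have hκ0 : 0 < κ := lt_min (by linarith) (by positivity)
  have hκ1 : κ ≤ ε / 2 := min_le_left _ _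
  have hκ2 : L ^ q * κ < ε ^ q - (ε / 2) ^ q := by
    have h1 : κ * (2 * (L ^ q + 1)) ≤ ε ^ q - (ε / 2) ^ q :=
      (le_div_iff₀ (by positivity)).1 (min_le_right _ _)
    nlinarith
  constructor
  · calc P {ω | ENNReal.ofReal ε < X ω} ≤ P B := by
          refine measure_mono_ae ?_
          filter_upwards [hXB] with ω hω (h : ENNReal.ofReal ε < X ω)
          by_contra hωB
          exact absurd ((hω hωB).trans (ENNReal.ofReal_le_ofReal (by linarith))) (not_le.2 h)
      _ ≤ ENNReal.ofReal κ := hPB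
      _ < ENNReal.ofReal ε := (ENNReal.ofReal_lt_ofReal_iff hε).2 (by linarith)
  · have hint : ∫⁻ ω, X ω ^ q ∂P < ENNReal.ofReal (ε ^ q) := by
      calc ∫⁻ ω, X ω ^ q ∂P
          ≤ ∫⁻ ω, (ENNReal.ofReal ((ε / 2) ^ q) +
              B.indicator (fun _ => ENNReal.ofReal (L ^ q)) ω) ∂P := by
            refine lintegral_mono_ae ?_
            filter_upwards [hXL, hXB] with ω h1 h2
            by_cases hωB : ω ∈ B
            · rw [Set.indicator_of_mem hωB]
              refine le_add_left ?_
              rw [← ENNReal.ofReal_rpow_of_nonneg hL hq0.le]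
              exact ENNReal.rpow_le_rpow h1 hq0.le
            · rw [Set.indicator_of_notMem hωB, add_zero,
                ← ENNReal.ofReal_rpow_of_nonneg (by positivity) hq0.le]
              exact ENNReal.rpow_le_rpow (h2 hωB) hq0.le
        _ = ENNReal.ofReal ((ε / 2) ^ q) + ENNReal.ofReal (L ^ q) * P B := by
            rw [lintegral_add_left measurable_const, lintegral_indicator_const hB]
            simp
        _ ≤ ENNReal.ofReal ((ε / 2) ^ q) + ENNReal.ofReal (L ^ q) * ENNReal.ofReal κ := by
            gcongr
        _ = ENNReal.ofReal ((ε / 2) ^ q + L ^ q * κ) := by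
            rw [← ENNReal.ofReal_mul hLq, ENNReal.ofReal_add (by positivity) (by positivity)]
        _ < ENNReal.ofReal (ε ^ q) :=
            (ENNReal.ofReal_lt_ofReal_iff (by positivity)).2 (by linarith)
    calc (∫⁻ ω, X ω ^ q ∂P) ^ (1 / q) < (ENNReal.ofReal (ε ^ q)) ^ (1 / q) :=
          ENNReal.rpow_lt_rpow hint (by positivity)
      _ = ENNReal.ofReal ε := by
          rw [ENNReal.ofReal_rpow_of_nonneg (by positivity) (by positivity), ← Real.rpow_mul hε.le,
            mul_one_div_cancel hq0.ne', Real.rpow_one]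

/-- The values of the filters at the hidden node `j`: the filter of its outgoing weight, and the
filters of its incoming weights. -/
def nodePattern {d N : ℕ} (f : ParamIdx d N → Bool) (j : Fin N) : Bool × (Fin d → Bool) :=
  (f (.inl (.inr (0, j))), fun k => f (.inl (.inl (j, k))))

/-- Filters that act alike on all hidden nodes and independently on any two of them: `θ S` is the
probability that the outgoing weight of a node is kept, and that its incoming weights are kept
exactly where `S` is `true`. -/
structure IsNodewiseFilter {d N : ℕ} {Ω : Type*} [MeasurableSpace Ω] (P : Measure Ω)
    (θ : (Fin d → Bool) → ℝ) (g : Ω → ParamIdx d N → Bool) : Prop where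
  measurable : Measurable g
  prob_pattern : ∀ j S, P {ω | nodePattern (g ω) j = (true, S)} = ENNReal.ofReal (θ S)
  indep : Pairwise fun i j =>
    IndepFun (fun ω => nodePattern (g ω) i) (fun ω => nodePattern (g ω) j) P
  bias_on : ∀ i : BiasIdx N, ∀ᵐ ω ∂P, g ω (.inr i) = true

/-- The weight vector `a` with the entries outside of `S` replaced by `0`. -/
def mask {d : ℕ} (S : Fin d → Bool) (a : Fin d → ℝ) : Fin d → ℝ :=
  fun k => if S k then a k else 0

lemma measurable_nodePattern {d N : ℕ} (j : Fin N) :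
    Measurable fun f : ParamIdx d N → Bool => nodePattern f j :=
  measurable_of_finite _

/-- The function computed by a filtered network, sorted by the filter patterns of its nodes. -/
lemma network_filtered {d N : ℕ} (σ : ℝ → ℝ) (w : ParamIdx d N → ℝ) (f : ParamIdx d N → Bool)
    (hf : ∀ i, f (.inr i) = true) (hw : ∀ i, w (.inr (.inr i)) = 0) (x : Fin d → ℝ) :
    network σ (filtered w f) x = ∑ j, ∑ S, w (.inl (.inr (0, j))) *
      (if nodePattern f j = (true, S) then 1 else 0) *
      σ (mask S (fun k => w (.inl (.inl (j, k)))) ⬝ᵥ x + w (.inr (.inl j))) := by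
  simp only [network, layer, id, Pi.add_apply, mulVec, dotProduct, of_apply]
  simp only [filtered, hf, hw, if_true, mul_one, add_zero]
  refine Finset.sum_congr rfl fun j _ => ?_
  rw [Finset.sum_eq_single (fun k => f (.inl (.inl (j, k))))]
  · simp [nodePattern, mask]
  · intro S _ hS
    rw [if_neg]
    · simp
    · rintro h
      exact hS (Prod.ext_iff.1 h).2.symm
  · simp

/-- The relative frequency of the pattern `(true, S)` among finitely many nodes is unlikely to be
far from its probability. -/
lemma prob_frequency_deviation_le {d N m : ℕ} (hm : 0 < m) {Ω : Type*} [MeasurableSpace Ω]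
    (P : Measure Ω) [IsProbabilityMeasure P] {θ : (Fin d → Bool) → ℝ} (hθ : ∀ S, 0 ≤ θ S)
    {g : Ω → ParamIdx d N → Bool} (hg : IsNodewiseFilter P θ g) (u : Fin m → Fin N)
    (hu : Function.Injective u) (S : Fin d → Bool) {η : ℝ} (hη : 0 < η) :
    P {ω | η ≤ |(∑ l, if nodePattern (g ω) (u l) = (true, S) then (1 : ℝ) else 0) / m - θ S|} ≤
      ENNReal.ofReal (1 / (m * η ^ 2)) := by
  have hm' : (0 : ℝ) < m := by exact_mod_cast hm
  let φ : Bool × (Fin d → Bool) → ℝ := fun z => if z = (true, S) then 1 else 0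
  let X : Fin m → Ω → ℝ := fun l ω => φ (nodePattern (g ω) (u l))
  have hmeas : ∀ l, Measurable (X l) := fun l =>
    (measurable_of_finite φ).comp ((measurable_nodePattern (u l)).comp hg.measurable)
  have hbd : ∀ l ω, X l ω ∈ Set.Icc (0 : ℝ) 1 := by
    intro l ω
    simp only [X, φ]
    split_ifs <;> simp
  have hL2 : ∀ l, MemLp (X l) 2 P := fun l =>
    MemLp.of_bound (hmeas l).aestronglyMeasurable 1 (ae_of_all _ fun ω => by
      rw [Real.norm_eq_abs, abs_of_nonneg (hbd l ω).1]; exact (hbd l ω).2)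
  have hmean : ∀ l, ∫ ω, X l ω ∂P = θ S := by
    intro l
    have h1 : X l = Set.indicator {ω | nodePattern (g ω) (u l) = (true, S)} 1 := by
      ext ω
      simp [X, φ, Set.indicator_apply]
    have h2 : MeasurableSet {ω | nodePattern (g ω) (u l) = (true, S)} :=
      ((measurable_nodePattern (u l)).comp hg.measurable) (measurableSet_singleton _)
    rw [h1, integral_indicator_one h2, measureReal_def, hg.prob_pattern,
      ENNReal.toReal_ofReal (hθ S)]
  have hvar : Var[∑ l, X l; P] ≤ m := by
    rw [IndepFun.variance_sum (fun l _ => hL2 l)]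
    · calc ∑ l, Var[X l; P] ≤ ∑ _l : Fin m, (1 : ℝ) := by
            refine Finset.sum_le_sum fun l _ => ?_
            refine (variance_le_sq_of_bounded (ae_of_all _ (hbd l)) (hmeas l).aemeasurable).trans ?_
            norm_num
        _ = m := by simp
    · intro i _ j _ hij
      exact (hg.indep (hu.ne hij)).comp (measurable_of_finite φ) (measurable_of_finite φ)
  have hsum : MemLp (∑ l, X l) 2 P := memLp_finsetSum' _ fun l _ => hL2 l
  have hE : ∫ ω, (∑ l, X l) ω ∂P = m * θ S := by
    simp only [Finset.sum_apply]
    rw [integral_finsetSum _ fun l _ => (hL2 l).integrable (by norm_num)]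
    simp [hmean]
  have hch := meas_ge_le_variance_div_sq hsum (c := m * η) (by positivity)
  rw [hE] at hch
  refine le_trans (le_of_eq ?_) (hch.trans (ENNReal.ofReal_le_ofReal ?_))
  · congr 1
    ext ω
    simp only [Set.mem_ofPred_eq, Finset.sum_apply]
    have : (∑ l, X l ω) - m * θ S = m * ((∑ l, X l ω) / m - θ S) := by
      field_simp
    rw [this, abs_mul, abs_of_pos hm', mul_le_mul_iff_right₀ hm']
  · rw [div_le_div_iff₀ (by positivity) (by positivity)]
    have := mul_le_mul_of_nonneg_right hvar (show 0 ≤ m * η ^ 2 by positivity)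
    nlinarith

/-! ### Networks with many copies of each node -/

lemma eLpNorm_sum_smul_le {α κ : Type*} [MeasurableSpace α] {μ : Measure α} {r : ℝ≥0∞}
    (hr : 1 ≤ r) (s : Finset κ) (t : κ → ℝ) {f : κ → α → ℝ} (hf : ∀ i, MemLp (f i) r μ) :
    eLpNorm (fun x => ∑ i ∈ s, t i * f i x) r μ ≤
      ENNReal.ofReal (∑ i ∈ s, |t i| * (eLpNorm (f i) r μ).toReal) := by
  have h1 : (fun x => ∑ i ∈ s, t i * f i x) = ∑ i ∈ s, t i • f i := by
    ext x
    simp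
  rw [h1]
  refine (eLpNorm_sum_le (fun i _ => (hf i).1.const_smul (t i)) hr).trans ?_
  rw [ENNReal.ofReal_sum_of_nonneg fun i _ => by positivity]
  refine Finset.sum_le_sum fun i _ => ?_
  rw [eLpNorm_const_smul, ENNReal.ofReal_mul (abs_nonneg _), ENNReal.ofReal_toReal (hf i).2.ne,
    Real.enorm_eq_ofReal_abs]

/-- Averaging over many copies of each hidden node turns a random network into the combination of
its expected nodes: if that combination is close to `ζ`, some filtered network is close to `ζ`. -/
theorem exists_network_of_expected_combination {d : ℕ} {μ : Measure (Fin d → ℝ)} {r : ℝ≥0∞}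
    (hr : 1 ≤ r) {σ : ℝ → ℝ}
    (hσ_Lr : ∀ (a : Fin d → ℝ) (b : ℝ), MemLp (fun x => σ (a ⬝ᵥ x + b)) r μ)
    {θ : (Fin d → Bool) → ℝ} (hθ₀ : ∀ S, 0 ≤ θ S) (hθ₁ : ∀ S, θ S ≤ 1)
    {q : ℝ} (hq : 1 ≤ q) {ζ : (Fin d → ℝ) → ℝ} (hζ : MemLp ζ r μ) {ε : ℝ} (hε : 0 < ε)
    {ι : Type*} [Fintype ι] (c : ι → ℝ) (a : ι → Fin d → ℝ) (b : ι → ℝ)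
    (hG : eLpNorm (fun x => ∑ i, c i * ∑ S, θ S * σ (mask S (a i) ⬝ᵥ x + b i) - ζ x) r μ ≤
      ENNReal.ofReal (ε / 4)) :
    ∃ (N : ℕ) (w : ParamIdx d N → ℝ), (∀ i, w (.inr (.inr i)) = 0) ∧
      ∀ (Ω : Type*) [MeasurableSpace Ω] (P : Measure Ω) [IsProbabilityMeasure P]
        (g : Ω → ParamIdx d N → Bool), IsNodewiseFilter P θ g →
        ApproxInProbAndLq μ r q ε P (fun ω => network σ (filtered w (g ω))) ζ := by
  classical
  let τ : ι × (Fin d → Bool) → (Fin d → ℝ) → ℝ := fun z x => σ (mask z.2 (a z.1) ⬝ᵥ x + b z.1)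
  have hτ : ∀ z, MemLp (τ z) r μ := fun z => hσ_Lr _ _
  set C : ℝ := ∑ z, |c z.1| * (eLpNorm (τ z) r μ).toReal with hC
  have hC0 : 0 ≤ C := Finset.sum_nonneg fun z _ => by positivity
  obtain ⟨κ, hκ0, hκ⟩ := exists_exceptional_prob (q := q) (ε := ε) (L := ε / 4 + C) hq hε
    (by positivity)
  set η : ℝ := ε / (4 * (C + 1)) with hη
  have hη0 : 0 < η := by positivity
  have hηC : η * C ≤ ε / 4 := by
    rw [hη, div_mul_eq_mul_div, div_le_div_iff₀ (by positivity) (by positivity)]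
    nlinarith
  -- the number `m` of copies of each node makes all frequencies accurate up to `η`, outside an
  -- event of probability at most `κ`
  obtain ⟨m, hm⟩ := exists_nat_gt (Fintype.card (ι × (Fin d → Bool)) / (κ * η ^ 2) : ℝ)
  have hm' : (0 : ℝ) < m := lt_of_le_of_lt (by positivity) hm
  have hm0 : 0 < m := by exact_mod_cast hm'
  let e := Fintype.equivFin (ι × Fin m)
  let w : ParamIdx d (Fintype.card (ι × Fin m)) → ℝ := Sum.elim
    (Sum.elim (fun jk => a (e.symm jk.1).1 jk.2) (fun ij => c (e.symm ij.2).1 / m))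
    (Sum.elim (fun j => b (e.symm j).1) (fun _ => 0))
  refine ⟨_, w, fun i => rfl, ?_⟩
  intro Ω _ P _ g hg
  let freq : ι × (Fin d → Bool) → Ω → ℝ := fun z ω =>
    (∑ l, if nodePattern (g ω) (e (z.1, l)) = (true, z.2) then (1 : ℝ) else 0) / m
  have hfreq_meas : ∀ z, Measurable (freq z) := fun z =>
    (measurable_of_finite fun f : ParamIdx d (Fintype.card (ι × Fin m)) → Bool =>
      (∑ l, if nodePattern f (e (z.1, l)) = (true, z.2) then (1 : ℝ) else 0) / m).comp hg.measurable
  have hfreq_dev : ∀ z ω, |freq z ω - θ z.2| ≤ 1 := by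
    intro z ω
    have h0 : 0 ≤ freq z ω := by
      refine div_nonneg (Finset.sum_nonneg fun l _ => ?_) hm'.le
      split_ifs <;> simp
    have h1 : freq z ω ≤ 1 := by
      rw [div_le_one hm']
      calc _ ≤ ∑ _l : Fin m, (1 : ℝ) := Finset.sum_le_sum fun l _ => by split_ifs <;> simp
        _ = m := by simp
    rw [abs_le]
    constructor <;> linarith [hθ₀ z.2, hθ₁ z.2]
  have hnet : ∀ᵐ ω ∂P, ∀ x, network σ (filtered w (g ω)) x =
      ∑ z : ι × (Fin d → Bool), c z.1 * freq z ω * τ z x := by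
    filter_upwards [ae_all_iff.2 hg.bias_on] with ω hω x
    rw [network_filtered σ w (g ω) hω (fun i => rfl), ← e.sum_comp, Fintype.sum_prod_type,
      Fintype.sum_prod_type]
    refine Finset.sum_congr rfl fun i _ => ?_
    rw [Finset.sum_comm]
    refine Finset.sum_congr rfl fun S _ => ?_
    simp only [w, freq, τ, Sum.elim_inl, Sum.elim_inr, Equiv.symm_apply_apply]
    rw [← Finset.sum_mul, ← Finset.mul_sum]
    ring
  have hbound : ∀ᵐ ω ∂P, eLpNorm (fun x => network σ (filtered w (g ω)) x - ζ x) r μ ≤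
      ENNReal.ofReal (ε / 4 + ∑ z : ι × (Fin d → Bool),
        |freq z ω - θ z.2| * (|c z.1| * (eLpNorm (τ z) r μ).toReal)) := by
    filter_upwards [hnet] with ω hω
    have hsplit : (fun x => network σ (filtered w (g ω)) x - ζ x) =
        (fun x => ∑ i, c i * ∑ S, θ S * σ (mask S (a i) ⬝ᵥ x + b i) - ζ x) +
        fun x => ∑ z : ι × (Fin d → Bool), c z.1 * (freq z ω - θ z.2) * τ z x := by
      ext x
      have : ∑ i, c i * ∑ S, θ S * σ (mask S (a i) ⬝ᵥ x + b i) =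
          ∑ z : ι × (Fin d → Bool), c z.1 * θ z.2 * τ z x := by
        rw [Fintype.sum_prod_type]
        refine Finset.sum_congr rfl fun i _ => ?_
        rw [Finset.mul_sum]
        refine Finset.sum_congr rfl fun S _ => ?_
        simp only [τ]
        ring
      simp only [Pi.add_apply, this, hω, mul_sub, sub_mul, Finset.sum_sub_distrib]
      ring
    have hGmem : MemLp (fun x => ∑ i, c i * ∑ S, θ S * σ (mask S (a i) ⬝ᵥ x + b i)) r μ :=
      memLp_finsetSum Finset.univ
        (f := fun i x => c i * ∑ S, θ S * σ (mask S (a i) ⬝ᵥ x + b i)) fun i _ =>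
        MemLp.const_mul (memLp_finsetSum Finset.univ
          (f := fun S x => θ S * σ (mask S (a i) ⬝ᵥ x + b i)) fun S _ =>
            (hσ_Lr (mask S (a i)) (b i)).const_mul (θ S)) (c i)
    have hDmem : MemLp (fun x => ∑ z : ι × (Fin d → Bool), c z.1 * (freq z ω - θ z.2) * τ z x)
        r μ :=
      memLp_finsetSum Finset.univ (f := fun z x => c z.1 * (freq z ω - θ z.2) * τ z x)
        fun z _ => (hτ z).const_mul (c z.1 * (freq z ω - θ z.2))
    rw [hsplit, ENNReal.ofReal_add (by positivity)
      (Finset.sum_nonneg fun z _ => by positivity)]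
    refine (eLpNorm_add_le (hGmem.sub hζ).1 hDmem.1 hr).trans (add_le_add hG ?_)
    refine (eLpNorm_sum_smul_le hr _ _ hτ).trans (ENNReal.ofReal_le_ofReal (le_of_eq ?_))
    refine Finset.sum_congr rfl fun z _ => ?_
    rw [abs_mul]
    ring
  refine hκ P _ (⋃ z, {ω | η ≤ |freq z ω - θ z.2|}) ?_ ?_ ?_ ?_
  · exact MeasurableSet.iUnion fun z =>
      measurableSet_le measurable_const ((hfreq_meas z).sub_const _).abs
  · filter_upwards [hbound] with ω hω
    refine hω.trans (ENNReal.ofReal_le_ofReal ?_)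
    rw [hC]
    refine add_le_add le_rfl (Finset.sum_le_sum fun z _ => ?_)
    exact mul_le_of_le_one_left (by positivity) (hfreq_dev z ω)
  · filter_upwards [hbound] with ω hω hB
    refine hω.trans (ENNReal.ofReal_le_ofReal ?_)
    have hle : ∀ z, |freq z ω - θ z.2| ≤ η := by
      intro z
      by_contra! h
      exact hB (Set.mem_iUnion.2 ⟨z, h.le⟩)
    calc ε / 4 + ∑ z : ι × (Fin d → Bool),
          |freq z ω - θ z.2| * (|c z.1| * (eLpNorm (τ z) r μ).toReal)
        ≤ ε / 4 + ∑ z : ι × (Fin d → Bool), η * (|c z.1| * (eLpNorm (τ z) r μ).toReal) := by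
          gcongr with z
          exact hle z
      _ = ε / 4 + η * C := by rw [hC, Finset.mul_sum]
      _ ≤ ε / 2 := by linarith
  · calc P (⋃ z, {ω | η ≤ |freq z ω - θ z.2|})
        ≤ ∑ z, P {ω | η ≤ |freq z ω - θ z.2|} := measure_iUnion_fintype_le _ _
      _ ≤ ∑ _z : ι × (Fin d → Bool), ENNReal.ofReal (1 / (m * η ^ 2)) :=
          Finset.sum_le_sum fun z _ => prob_frequency_deviation_le hm0 P hθ₀ hg
            (fun l => e (z.1, l)) (fun l l' h => (Prod.ext_iff.1 (e.injective h)).2) z.2 hη0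
      _ = ENNReal.ofReal (Fintype.card (ι × (Fin d → Bool)) / (m * η ^ 2)) := by
          rw [Finset.sum_const, nsmul_eq_mul, Finset.card_univ, ← ENNReal.ofReal_natCast,
            ← ENNReal.ofReal_mul (by positivity), mul_one_div]
      _ ≤ ENNReal.ofReal κ := by
          refine ENNReal.ofReal_le_ofReal ?_
          rw [div_lt_iff₀ (by positivity)] at hm
          rw [div_le_iff₀ (by positivity)]
          nlinarith

/-! ### Dropconnect and node-dropout filters act nodewise -/

/-- Dropconnect filters are independent over the hidden nodes, because the filters of different
nodes are functions of disjoint families of independent variables. -/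
lemma IsDropconnectFilter.isNodewiseFilter {d N : ℕ} {Ω : Type*} [MeasurableSpace Ω]
    {P : Measure Ω} [IsProbabilityMeasure P] {p : ℝ} (hp₀ : 0 ≤ p) (hp₁ : p ≤ 1)
    {g : Ω → ParamIdx d N → Bool} (hg : IsDropconnectFilter P p g) :
    IsNodewiseFilter P (fun S => (1 - p) * ∏ k, if S k then 1 - p else p) g := by
  have hmi : ∀ i, Measurable fun ω => g ω i := fun i => (measurable_pi_apply i).comp hg.measurable
  refine ⟨hg.measurable, ?_, ?_, hg.bias_on⟩
  · intro j S
    have hval : ∀ (i : WeightIdx d N) (t : Bool),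
        P ((fun ω => g ω (.inl i)) ⁻¹' {t}) = ENNReal.ofReal (if t then 1 - p else p) := by
      intro i t
      have h1 : P ((fun ω => g ω (.inl i)) ⁻¹' {true}) = ENNReal.ofReal (1 - p) := hg.prob_weight i
      cases t
      · have h2 : (fun ω => g ω (.inl i)) ⁻¹' {false} = ((fun ω => g ω (.inl i)) ⁻¹' {true})ᶜ := by
          ext ω
          simp
        rw [h2, prob_compl_eq_one_sub ((hmi _) (measurableSet_singleton _)), h1,
          ← ENNReal.ofReal_one, ← ENNReal.ofReal_sub _ (by linarith)]
        simp
      · simpa using h1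
    let v : Fin 1 ⊕ Fin d → WeightIdx d N :=
      Sum.elim (fun _ => .inr (0, j)) (fun k => .inl (j, k))
    have hv : Function.Injective v := by
      rintro (i | i) (i' | i') h
      · exact congrArg _ (Subsingleton.elim i i')
      · simp [v] at h
      · simp [v] at h
      · simpa [v] using h
    let t : Fin 1 ⊕ Fin d → Bool := Sum.elim (fun _ => true) S
    have h := (hg.indep.precomp hv).measure_inter_preimage_eq_mul Finset.univ
      (sets := fun i => {t i}) fun i _ => measurableSet_singleton _
    have hset : {ω | nodePattern (g ω) j = (true, S)} =
        ⋂ i ∈ Finset.univ, (fun ω => g ω (.inl (v i))) ⁻¹' {t i} := by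
      ext ω
      simp [v, t, nodePattern, Prod.ext_iff, funext_iff]
    rw [hset]
    refine h.trans ?_
    simp only [hval]
    rw [Fintype.prod_sum_type, ENNReal.ofReal_mul (by linarith), ENNReal.ofReal_prod_of_nonneg]
    · simp [t]
      rfl
    · intro k _
      split_ifs <;> linarith
  · intro i j hij
    let T : Fin N → Finset (WeightIdx d N) := fun j =>
      Finset.univ.filter fun z => Sum.elim Prod.fst Prod.snd z = j
    have hT : Disjoint (T i) (T j) := by
      rw [Finset.disjoint_left]
      intro z hz hz'
      simp only [T, Finset.mem_filter, Finset.mem_univ, true_and] at hz hz'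
      exact hij (hz.symm.trans hz')
    have h := hg.indep.indepFun_finset (T i) (T j) hT fun z => hmi _
    let φ : ∀ j, (T j → Bool) → Bool × (Fin d → Bool) := fun j f =>
      (f ⟨.inr (0, j), by simp [T]⟩, fun k => f ⟨.inl (j, k), by simp [T]⟩)
    exact h.comp (measurable_of_finite (φ i)) (measurable_of_finite (φ j))

/-- Without dropout on the inputs, a node is either kept with all its incoming weights or has its
outgoing weight removed. -/
lemma IsNodeDropoutFilter.isNodewiseFilter {d N : ℕ} {Ω : Type*} [MeasurableSpace Ω]
    {P : Measure Ω} [IsProbabilityMeasure P] {p : ℝ}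
    {g : Ω → ParamIdx d N → Bool} (hg : IsNodeDropoutFilter P 0 p g) :
    IsNodewiseFilter P (fun S => if S = fun _ => true then 1 - p else 0) g := by
  obtain ⟨D, hD, hind, hin, hhid, hgin, hghid⟩ := hg.node
  have hDin : ∀ k, ∀ᵐ ω ∂P, D (.inl k) ω = true := by
    intro k
    have hm : MeasurableSet {ω | D (.inl k) ω = true} := hD _ (measurableSet_singleton true)
    exact (mem_ae_iff_prob_eq_one hm).2 (by rw [hin]; simp)
  have hpat : ∀ j, ∀ᵐ ω ∂P, nodePattern (g ω) j = (D (.inr j) ω, fun _ => true) := by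
    intro j
    filter_upwards [ae_all_iff.2 hDin, ae_all_iff.2 (hgin j), hghid 0 j] with ω h1 h2 h3
    simp [nodePattern, h1, h2, h3]
  refine ⟨hg.measurable, ?_, ?_, hg.bias_on⟩
  · intro j S
    split_ifs with hS
    · rw [← hhid j]
      refine measure_congr ?_
      filter_upwards [hpat j] with ω h
      refine propext ?_
      change nodePattern (g ω) j = (true, S) ↔ D (.inr j) ω = true
      simp [h, hS]
    · rw [ENNReal.ofReal_zero]
      refine measure_eq_zero_iff_ae_notMem.2 ?_
      filter_upwards [hpat j] with ω h (h' : nodePattern (g ω) j = (true, S))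
      rw [h] at h'
      exact hS (Prod.ext_iff.1 h').2.symm
  · intro i j hij
    refine IndepFun.congr (f := fun ω => (D (.inr i) ω, fun _ : Fin d => true))
      (g := fun ω => (D (.inr j) ω, fun _ : Fin d => true)) ?_ ?_ ?_
    · exact (hind.indepFun (by simpa using hij : (Sum.inr i : Fin d ⊕ Fin N) ≠ .inr j)).comp
        (φ := fun z => (z, fun _ : Fin d => true)) (ψ := fun z => (z, fun _ : Fin d => true))
        (measurable_of_finite _) (measurable_of_finite _)
    · filter_upwards [hpat i] with ω h using h.symm
    · filter_upwards [hpat j] with ω h using h.symm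

/-! ### Local integrability from integrability of translates -/

section
open Filter Topology
open scoped Pointwise

/-- If every translate of `g` has a finite integral with respect to one absolutely continuous
probability measure `ν`, then `g` is locally integrable. Averaging the integrals over the
translations by `t₀ - s` with `s` in a compact set `E` on which `ν` has a density bounded below
gives `∫ g u * volume (E ∩ (E - (u - t₀))) du < ∞`, and the weight is bounded below for `u` near
`t₀` by continuity of translation. -/
lemma exists_nhds_setLIntegral_lt_top_of_translates {g : ℝ → ℝ≥0∞} (hg : Measurable g)
    {ν : Measure ℝ} [IsProbabilityMeasure ν] (hν : ν ≪ volume)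
    (h : ∀ b, ∫⁻ t, g (t + b) ∂ν < ∞) (t₀ : ℝ) : ∃ U ∈ 𝓝 t₀, ∫⁻ t in U, g t < ∞ := by
  set ρ := ν.rnDeriv volume with hρ
  have hρm : Measurable ρ := Measure.measurable_rnDeriv _ _
  have hνρ : volume.withDensity ρ = ν := Measure.withDensity_rnDeriv_eq _ _ hν
  let F : ℝ → ℝ≥0∞ := fun b => ∫⁻ t, g (t + b) ∂ν
  have hF : Measurable F :=
    Measurable.lintegral_prod_right' (f := fun z : ℝ × ℝ => g (z.2 + z.1))
      (hg.comp (measurable_snd.add measurable_fst))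
  -- these sets exhaust the set of positive density, because `F` is finite everywhere
  let A : ℕ → Set ℝ := fun n => {s | ((n : ℝ≥0∞) + 1)⁻¹ ≤ ρ s ∧ F (t₀ - s) ≤ n}
  have hA : ∀ n, MeasurableSet (A n) := fun n =>
    (measurableSet_le measurable_const hρm).inter
      (measurableSet_le (hF.comp (measurable_const.sub measurable_id)) measurable_const)
  have hApos : ∃ n, volume (A n) ≠ 0 := by
    by_contra! hcon
    have hU : volume (⋃ n, A n) = 0 := measure_iUnion_null hcon
    have hρ0 : ρ =ᵐ[volume] 0 := by
      filter_upwards [measure_eq_zero_iff_ae_notMem.1 hU] with s hs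
      by_contra hne
      obtain ⟨n, hn⟩ := ENNReal.exists_inv_nat_lt hne
      obtain ⟨m, hm⟩ := ENNReal.exists_nat_gt (h (t₀ - s)).ne
      refine hs (Set.mem_iUnion.2 ⟨max n m, ?_, ?_⟩)
      · refine le_trans (ENNReal.inv_le_inv.2 ?_) hn.le
        exact le_trans (by exact_mod_cast le_max_left n m) le_self_add
      · exact hm.le.trans (by exact_mod_cast le_max_right n m)
    have : ν = 0 := by rw [← hνρ, withDensity_congr_ae hρ0, withDensity_zero]
    exact IsProbabilityMeasure.ne_zero ν this
  obtain ⟨n, hn⟩ := hApos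
  obtain ⟨E, hEA, hE, hE0⟩ := (hA n).exists_lt_isCompact (pos_iff_ne_zero.2 hn)
  have hEm := hE.measurableSet
  have hEfin : volume E ≠ ∞ := hE.measure_lt_top.ne
  -- the weight with which `g u` enters the averaged integral
  let wt : ℝ → ℝ≥0∞ := fun u => ∫⁻ s in E, E.indicator 1 (u - t₀ + s)
  have hmeas2 : Measurable fun z : ℝ × ℝ => E.indicator (1 : ℝ → ℝ≥0∞) (z.2 - t₀ + z.1) * g z.2 :=
    ((measurable_one.indicator hEm).comp ((measurable_snd.sub_const _).add measurable_fst)).mul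
      (hg.comp measurable_snd)
  have hfin : ∫⁻ u, wt u * g u < ∞ := by
    have hstep : ∀ s ∈ E, ∫⁻ u, E.indicator 1 (u - t₀ + s) * g u ≤ ((n : ℝ≥0∞) + 1) * n := by
      intro s hs
      have hsF : F (t₀ - s) ≤ n := (hEA hs).2
      calc ∫⁻ u, E.indicator 1 (u - t₀ + s) * g u
          = ∫⁻ t, E.indicator 1 t * g (t + (t₀ - s)) := by
            rw [← lintegral_add_right_eq_self _ (t₀ - s)]
            refine lintegral_congr fun t => ?_
            congr 2
            ring
        _ ≤ ∫⁻ t, ((n : ℝ≥0∞) + 1) * (ρ t * g (t + (t₀ - s))) := by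
            refine lintegral_mono fun t => ?_
            by_cases ht : t ∈ E
            · rw [Set.indicator_of_mem ht, ← mul_assoc]
              gcongr
              have h1 := (hEA ht).1
              rw [ENNReal.inv_le_iff_le_mul (by simp) (by simp)] at h1
              simpa [mul_comm] using h1
            · simp [Set.indicator_of_notMem ht]
        _ = ((n : ℝ≥0∞) + 1) * F (t₀ - s) := by
            have hgm : Measurable fun t => g (t + (t₀ - s)) := hg.comp (measurable_id.add_const _)
            have hFs : F (t₀ - s) = ∫⁻ t, ρ t * g (t + (t₀ - s)) := by
              simp only [F]
              conv_lhs => rw [← hνρ]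
              exact lintegral_withDensity_eq_lintegral_mul _ hρm hgm
            rw [hFs]
            exact lintegral_const_mul _ (hρm.mul hgm)
        _ ≤ _ := by gcongr
    calc ∫⁻ u, wt u * g u = ∫⁻ u, ∫⁻ s in E, E.indicator 1 (u - t₀ + s) * g u := by
          refine lintegral_congr fun u => ?_
          rw [lintegral_mul_const]
          exact (measurable_one.indicator hEm).comp (measurable_const.add measurable_id)
      _ = ∫⁻ s in E, ∫⁻ u, E.indicator 1 (u - t₀ + s) * g u :=
          (lintegral_lintegral_swap hmeas2.aemeasurable).symm
      _ ≤ ∫⁻ _s in E, ((n : ℝ≥0∞) + 1) * n :=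
          setLIntegral_mono measurable_const hstep
      _ = ((n : ℝ≥0∞) + 1) * n * volume E := by simp
      _ < ∞ := by
          refine ENNReal.mul_lt_top (ENNReal.mul_lt_top ?_ ?_) hEfin.lt_top <;> simp
  have hlow : ∀ᶠ u in 𝓝 t₀, volume E / 2 ≤ wt u := by
    have ht : Tendsto (fun u : ℝ => volume (((u - t₀) +ᵥ E) \ E)) (𝓝 t₀) (𝓝 0) := by
      refine (tendsto_measure_vadd_sdiff_isCompact_isClosed (μ := volume) hE hE.isClosed).comp ?_
      have : Tendsto (fun u : ℝ => u - t₀) (𝓝 t₀) (𝓝 (t₀ - t₀)) :=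
        tendsto_id.sub_const t₀
      rwa [sub_self] at this
    have hlt := ht.eventually (gt_mem_nhds (ENNReal.half_pos hE0.ne'))
    filter_upwards [hlt] with u hu
    let T : Set ℝ := (fun s => u - t₀ + s) ⁻¹' E
    have hTm : MeasurableSet T := hEm.preimage (measurable_const.add measurable_id)
    have hwt : wt u = volume (T ∩ E) := by
      have : (fun s => E.indicator (1 : ℝ → ℝ≥0∞) (u - t₀ + s)) = T.indicator 1 := by
        ext s
        by_cases hs : u - t₀ + s ∈ E <;> simp [T, hs]
      simp only [wt]
      rw [this, lintegral_indicator_one hTm, Measure.restrict_apply hTm]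
    have hdiff : volume (E \ T) = volume (((u - t₀) +ᵥ E) \ E) := by
      have : E \ T = (fun s => u - t₀ + s) ⁻¹' (((u - t₀) +ᵥ E) \ E) := by
        ext s
        simp [T, Set.mem_vadd_set]
      rw [this, measure_preimage_add]
    have hsum : volume E ≤ wt u + volume E / 2 := by
      calc volume E = volume (E ∩ T) + volume (E \ T) := (measure_inter_add_sdiff E hTm).symm
        _ ≤ wt u + volume E / 2 := by
            rw [hwt, hdiff, Set.inter_comm]
            gcongr
    have hhalf : volume E / 2 + volume E / 2 ≤ wt u + volume E / 2 := by
      rwa [ENNReal.add_halves]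
    exact (ENNReal.add_le_add_iff_right (ENNReal.div_ne_top hEfin (by simp))).1 hhalf
  refine ⟨_, hlow, ?_⟩
  have hmul : volume E / 2 * ∫⁻ t in {u | volume E / 2 ≤ wt u}, g t < ∞ := by
    refine lt_of_le_of_lt ?_ hfin
    rw [← lintegral_const_mul _ hg]
    refine le_trans ?_ (setLIntegral_le_lintegral {u | volume E / 2 ≤ wt u} _)
    have hwtm : Measurable wt :=
      Measurable.lintegral_prod_right' (f := fun z : ℝ × ℝ => E.indicator 1 (z.1 - t₀ + z.2))
        ((measurable_one.indicator hEm).comp ((measurable_fst.sub_const _).add measurable_snd))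
    refine setLIntegral_mono (hwtm.mul hg) fun u hu => ?_
    gcongr
    exact hu
  exact (ENNReal.mul_lt_top_iff.1 hmul).elim (fun h => h.2) fun h => h.elim
    (fun h => absurd h (ENNReal.half_pos hE0.ne').ne') (fun h => by simp [h])

end

/-! ### Mollifications that are polynomials -/

section
open Filter Topology
open scoped Convolution ContDiff

lemma exists_polynomial_derivative_eq (P : Polynomial ℝ) (k : ℕ) (hP : P.degree < k) :
    ∃ Q : Polynomial ℝ, Q.derivative = P ∧ Q.degree < (k + 1 : ℕ) := by
  refine ⟨∑ i ∈ Finset.range k, Polynomial.monomial (i + 1) (P.coeff i / (i + 1)), ?_, ?_⟩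
  · rw [Polynomial.derivative_sum]
    ext j
    simp only [Polynomial.derivative_monomial, Polynomial.finsetSum_coeff,
      Polynomial.coeff_monomial]
    have : ∀ i : ℕ, P.coeff i / ((i : ℝ) + 1) * ((i + 1 : ℕ) : ℝ) = P.coeff i := by
      intro i
      have : ((i : ℝ) + 1) ≠ 0 := by positivity
      push_cast
      field_simp
    simp only [this, Nat.add_sub_cancel, Finset.sum_ite_eq', Finset.mem_range]
    split_ifs with hj
    · rfl
    · exact (Polynomial.coeff_eq_zero_of_degree_lt
        (hP.trans_le (by exact_mod_cast not_lt.1 hj))).symm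
  · refine (Polynomial.degree_sum_le _ _).trans_lt ?_
    rw [Finset.sup_lt_iff (by simp)]
    intro i hi
    refine (Polynomial.degree_monomial_le _ _).trans_lt ?_
    have := Finset.mem_range.1 hi
    exact_mod_cast Nat.succ_lt_succ this

lemma exists_polynomial_of_iteratedDeriv_eq_zero (k : ℕ) :
    ∀ f : ℝ → ℝ, ContDiff ℝ k f → (∀ t, iteratedDeriv k f t = 0) →
      ∃ P : Polynomial ℝ, P.degree < k ∧ ∀ t, f t = P.eval t := by
  induction k with
  | zero =>
    intro f _ h
    exact ⟨0, by simp, fun t => by simpa using h t⟩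
  | succ k ih =>
    intro f hf h
    have hf' : ContDiff ℝ ((k : ℕ∞) + 1) f := by exact_mod_cast hf
    obtain ⟨P, hPk, hP⟩ := ih (deriv f) (contDiff_succ_iff_deriv.1 hf').2.2
      (fun t => by rw [← iteratedDeriv_succ']; exact h t)
    obtain ⟨Q, hQP, hQk⟩ := exists_polynomial_derivative_eq P k hPk
    have hdf : Differentiable ℝ f := hf.differentiable (by simp)
    have hconst : ∀ t, f t - Q.eval t = f 0 - Q.eval 0 := by
      intro t
      refine is_const_of_deriv_eq_zero (f := fun t => f t - Q.eval t)
        (hdf.sub Q.differentiable) (fun s => ?_) t 0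
      rw [deriv_fun_sub (hdf s) Q.differentiableAt, hP, Polynomial.deriv, hQP, sub_self]
    refine ⟨Q + Polynomial.C (f 0 - Q.eval 0), ?_, fun t => ?_⟩
    · refine (Polynomial.degree_add_le _ _).trans_lt (max_lt hQk ?_)
      exact Polynomial.degree_C_le.trans_lt (by exact_mod_cast Nat.succ_pos k)
    · simp only [Polynomial.eval_add, Polynomial.eval_C]
      linarith [hconst t]

/-- An almost everywhere limit of polynomials of degree less than `k` is almost everywhere such a
polynomial, by Lagrange interpolation at `k` points of convergence. -/
lemma exists_polynomial_of_ae_tendsto {σ : ℝ → ℝ} {k : ℕ} (P : ℕ → Polynomial ℝ)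
    (hP : ∀ n, (P n).degree < k)
    (h : ∀ᵐ t, Tendsto (fun n => (P n).eval t) atTop (𝓝 (σ t))) :
    ∃ Q : Polynomial ℝ, ∀ᵐ t, σ t = Q.eval t := by
  have hinf : {t | Tendsto (fun n => (P n).eval t) atTop (𝓝 (σ t))}.Infinite := by
    intro hfin
    obtain ⟨t, ht, ht'⟩ :=
      (h.and (measure_eq_zero_iff_ae_notMem.1 (hfin.measure_zero volume))).exists
    exact ht' ht
  obtain ⟨s, hs, hcard⟩ := hinf.exists_subset_card_eq k
  refine ⟨Lagrange.interpolate s id σ, ?_⟩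
  filter_upwards [h] with t ht
  refine tendsto_nhds_unique ht ?_
  have hPn : ∀ n, (P n).eval t = ∑ i ∈ s, (P n).eval i * (Lagrange.basis s id i).eval t := by
    intro n
    conv_lhs => rw [Lagrange.eq_interpolate (s := s) (v := id) (f := P n) (Set.injOn_id _)
      (by rw [hcard]; exact hP n)]
    simp [Lagrange.interpolate_apply, Polynomial.eval_finsetSum]
  simp only [hPn, Lagrange.interpolate_apply, Polynomial.eval_finsetSum, Polynomial.eval_mul,
    Polynomial.eval_C]
  exact tendsto_finsetSum _ fun i hi => (hs hi).mul_const _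

/-- If all derivatives of order `k` of all mollifications of `σ` vanished, the mollifications would
be polynomials of degree less than `k`, and hence so would be their almost everywhere limit `σ`. -/
theorem exists_convolution_iteratedDeriv_ne_zero {σ : ℝ → ℝ} (hσ : LocallyIntegrable σ volume)
    (hσ_poly : ¬ ∃ Q : Polynomial ℝ, ∀ᵐ t ∂(volume : Measure ℝ), σ t = Q.eval t) (k : ℕ) :
    ∃ φ : ℝ → ℝ, ContDiff ℝ ∞ φ ∧ HasCompactSupport φ ∧
      ∃ b, iteratedDeriv k (φ ⋆[ContinuousLinearMap.lsmul ℝ ℝ, volume] σ) b ≠ 0 := by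
  by_contra! hcon
  let B : ℕ → ContDiffBump (0 : ℝ) := fun n =>
    ⟨1 / (n + 1), 2 / (n + 1), by positivity, by gcongr; norm_num⟩
  have hB : Tendsto (fun n => (B n).rOut) atTop (𝓝 0) := by
    have := (tendsto_one_div_add_atTop_nhds_zero_nat (𝕜 := ℝ)).const_mul 2
    simpa [B, div_eq_mul_inv] using this
  have hlim := ContDiffBump.ae_convolution_tendsto_right_of_locallyIntegrable (K := 2) hB
    (Eventually.of_forall fun n => le_of_eq (by simp only [B]; ring)) hσ
  have hpoly : ∀ n, ∃ P : Polynomial ℝ, P.degree < k ∧ ∀ t,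
      ((B n).normed volume ⋆[ContinuousLinearMap.lsmul ℝ ℝ, volume] σ) t = P.eval t := by
    intro n
    refine exists_polynomial_of_iteratedDeriv_eq_zero k _ ?_
      (hcon _ (B n).contDiff_normed (B n).hasCompactSupport_normed)
    exact ((B n).hasCompactSupport_normed.contDiff_convolution_left (n := (k : ℕ∞)) _
      (B n).contDiff_normed hσ)
  choose P hPk hP using hpoly
  refine hσ_poly (exists_polynomial_of_ae_tendsto P hPk ?_)
  simpa only [hP] using hlim

end

/-! ### Integrals of functions with values in `L^r` -/

section

/-- In a separable space every open set is a countable union of balls, so that measurability can be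
tested on distances. -/
lemma measurable_of_measurable_edist {Y E : Type*} [MeasurableSpace Y] [PseudoEMetricSpace E]
    [SecondCountableTopology E] [MeasurableSpace E] [BorelSpace E] {f : Y → E}
    (h : ∀ z, Measurable fun y => edist (f y) z) : Measurable f := by
  refine measurable_of_isOpen fun U hU => ?_
  choose! ρ hρ0 hρ using fun z (hz : z ∈ U) => EMetric.isOpen_iff.1 hU z hz
  obtain ⟨T, hTc, hT⟩ := TopologicalSpace.isOpen_iUnion_countable
    (fun z : U => Metric.eball (z : E) (ρ z)) fun z => Metric.isOpen_eball
  have hUT : U = ⋃ z ∈ T, Metric.eball (z : E) (ρ z) := by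
    rw [hT]
    refine Set.Subset.antisymm (fun z hz => ?_) (Set.iUnion_subset fun z => hρ z z.2)
    exact Set.mem_iUnion.2 ⟨⟨z, hz⟩, Metric.mem_eball_self (hρ0 z hz)⟩
  rw [hUT, Set.preimage_iUnion₂]
  exact MeasurableSet.biUnion hTc fun z _ => measurableSet_lt (h z) measurable_const

variable {X Y : Type*} [MeasurableSpace X] [MeasurableSpace Y] {μ : Measure X} {r : ℝ≥0∞}

lemma measurable_eLpNorm_section [SFinite μ] (hr : r ≠ 0) (hr_top : r ≠ ∞) {G : Y × X → ℝ}
    (hG : Measurable G) : Measurable fun y => eLpNorm (fun x => G (y, x)) r μ := by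
  simp only [eLpNorm_eq_lintegral_rpow_enorm_toReal hr hr_top]
  exact (Measurable.lintegral_prod_right' (f := fun z : Y × X => ‖G z‖ₑ ^ r.toReal)
    (hG.enorm.pow_const _)).pow_const _

/-- Since `L^r(μ)` is separable, a jointly measurable family of `L^r` functions is a strongly
measurable map into `L^r(μ)`. -/
lemma stronglyMeasurable_toLp_section [MeasurableSpace.CountablyGenerated X] [IsFiniteMeasure μ]
    [Fact (1 ≤ r)] [Fact (r ≠ ∞)]
    {G : Y × X → ℝ} (hG : Measurable G) (hGm : ∀ y, MemLp (fun x => G (y, x)) r μ) :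
    StronglyMeasurable fun y => (hGm y).toLp := by
  borelize ↥(Lp ℝ r μ)
  have hr0 : r ≠ 0 := (lt_of_lt_of_le one_pos (Fact.out : 1 ≤ r)).ne'
  refine Measurable.stronglyMeasurable (measurable_of_measurable_edist fun z => ?_)
  have h : ∀ y, edist (hGm y).toLp z = eLpNorm (fun x => G (y, x) - z x) r μ := by
    intro y
    rw [Lp.edist_def]
    exact eLpNorm_congr_ae ((hGm y).coeFn_toLp.sub (ae_eq_refl _))
  simp only [h]
  exact measurable_eLpNorm_section (G := fun p : Y × X => G p - z p.2) hr0 Fact.out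
    (hG.sub ((Lp.stronglyMeasurable z).measurable.comp measurable_snd))

/-- Integration over a set, as a continuous linear functional on `L^r(μ)`. -/
lemma exists_setIntegral_clm [IsProbabilityMeasure μ] [Fact (1 ≤ r)] {s : Set X} :
    ∃ Λ : Lp ℝ r μ →L[ℝ] ℝ, ∀ f, Λ f = ∫ x in s, f x ∂μ := by
  have hint : ∀ f : Lp ℝ r μ, Integrable f μ := fun f => (Lp.memLp f).integrable Fact.out
  let Λ : Lp ℝ r μ →ₗ[ℝ] ℝ :=
    { toFun := fun f => ∫ x in s, f x ∂μ
      map_add' := fun f g => by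
        rw [← integral_add (hint f).integrableOn (hint g).integrableOn]
        exact integral_congr_ae (ae_restrict_of_ae (Lp.coeFn_add f g))
      map_smul' := fun c f => by
        rw [RingHom.id_apply, ← integral_smul]
        exact integral_congr_ae (ae_restrict_of_ae (Lp.coeFn_smul c f)) }
  refine ⟨Λ.mkContinuous 1 fun f => ?_, fun f => rfl⟩
  rw [one_mul]
  calc ‖∫ x in s, f x ∂μ‖ ≤ ∫ x in s, ‖f x‖ ∂μ := norm_integral_le_integral_norm _
    _ ≤ ∫ x, ‖f x‖ ∂μ := setIntegral_le_integral (hint f).norm (ae_of_all _ fun x => norm_nonneg _)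
    _ = (eLpNorm f 1 μ).toReal := by
        rw [eLpNorm_one_eq_lintegral_enorm, integral_norm_eq_lintegral_enorm (hint f).1]
    _ ≤ (eLpNorm f r μ).toReal := ENNReal.toReal_mono (Lp.eLpNorm_ne_top f)
        (eLpNorm_le_eLpNorm_of_exponent_le Fact.out (Lp.aestronglyMeasurable f))
    _ = ‖f‖ := rfl

/-- An integral in `L^r` of a jointly measurable family of functions can be computed pointwise:
both sides have the same integrals over all measurable sets, by Fubini's theorem. -/
lemma coeFn_integral_toLp [IsProbabilityMeasure μ] [Fact (1 ≤ r)] {lam : Measure Y} [SFinite lam]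
    {G : Y × X → ℝ} (hG : Measurable G) (hGm : ∀ y, MemLp (fun x => G (y, x)) r μ)
    (hint : Integrable (fun y => (hGm y).toLp) lam) :
    (∫ y, (hGm y).toLp ∂lam : Lp ℝ r μ) =ᵐ[μ] fun x => ∫ y, G (y, x) ∂lam := by
  have hprod : Integrable G (lam.prod μ) := by
    rw [integrable_prod_iff hG.aestronglyMeasurable]
    refine ⟨ae_of_all _ fun y => (hGm y).integrable Fact.out, ?_⟩
    refine hint.norm.mono'
      (hG.stronglyMeasurable.norm.integral_prod_right').aestronglyMeasurable
      (ae_of_all _ fun y => ?_)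
    rw [Real.norm_of_nonneg (integral_nonneg fun x => norm_nonneg _), Lp.norm_toLp,
      integral_norm_eq_lintegral_enorm (hGm y).1, ← eLpNorm_one_eq_lintegral_enorm]
    exact ENNReal.toReal_mono (hGm y).2.ne
      (eLpNorm_le_eLpNorm_of_exponent_le Fact.out (hGm y).1)
  refine Integrable.ae_eq_of_forall_setIntegral_eq _ _
    ((Lp.memLp _).integrable Fact.out) hprod.integral_prod_right fun s hs _ => ?_
  obtain ⟨Λ, hΛ⟩ := exists_setIntegral_clm (μ := μ) (r := r) (s := s)
  rw [← hΛ, ← Λ.integral_comp_comm hint]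
  have h1 : ∀ y, Λ (hGm y).toLp = ∫ x in s, G (y, x) ∂μ := fun y => by
    rw [hΛ]
    exact integral_congr_ae (ae_restrict_of_ae (hGm y).coeFn_toLp)
  simp only [h1]
  refine integral_integral_swap (f := fun y x => G (y, x)) ?_
  exact hprod.mono_measure (Measure.prod_mono le_rfl Measure.restrict_le_self)

lemma Submodule.integral_mem_of_isClosed {E : Type*} [NormedAddCommGroup E] [NormedSpace ℝ E]
    [CompleteSpace E] {V : Submodule ℝ E} (hV : IsClosed (V : Set E)) {lam : Measure Y}
    [IsFiniteMeasure lam] {f : Y → E} (hf : Integrable f lam) (hfV : ∀ᵐ y ∂lam, f y ∈ V) :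
    ∫ y, f y ∂lam ∈ V := by
  rcases eq_or_ne lam 0 with h | h
  · simp [h]
  · have : NeZero lam := ⟨h⟩
    rw [← measure_smul_average]
    exact V.smul_mem _ (V.convex.average_mem hV hfV hf)

end

/-! ### Mollified ridge functions -/

section
open scoped Convolution Topology

lemma ENNReal.rpow_inv_le_one_add (A : ℝ≥0∞) {t : ℝ} (ht : 1 ≤ t) : A ^ (1 / t) ≤ 1 + A := by
  rcases le_total A 1 with h | h
  · exact (ENNReal.rpow_le_one h (by positivity)).trans le_self_add
  · refine le_trans ?_ le_add_self
    calc A ^ (1 / t) ≤ A ^ (1 : ℝ) :=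
          ENNReal.rpow_le_rpow_of_exponent_le h ((div_le_one (by linarith)).2 ht)
      _ = A := ENNReal.rpow_one A

/-- Local finiteness of the measure with density `g` makes it finite on compact sets. -/
lemma setLIntegral_lt_top_of_isCompact_of_nhds {g : ℝ → ℝ≥0∞}
    (h : ∀ t, ∃ U ∈ 𝓝 t, ∫⁻ u in U, g u < ∞) {C : Set ℝ} (hC : IsCompact C) :
    ∫⁻ u in C, g u < ∞ := by
  have : IsLocallyFiniteMeasure (volume.withDensity g) := ⟨fun t => by
    obtain ⟨U, hU, hlt⟩ := h t
    obtain ⟨W, hWU, hWo, htW⟩ := mem_nhds_iff.1 hU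
    refine ⟨W, hWo.mem_nhds htW, ?_⟩
    rw [withDensity_apply _ hWo.measurableSet]
    exact (lintegral_mono_set hWU).trans_lt hlt⟩
  rw [← withDensity_apply _ hC.measurableSet]
  exact hC.measure_lt_top

variable {d : ℕ} {μ : Measure (Fin d → ℝ)} {r : ℝ≥0∞}

/-- An almost everywhere property of real numbers holds along a nonconstant affine function, almost
everywhere with respect to an absolutely continuous measure. -/
lemma ae_comp_affine (hμ : μ ≪ volume) {Q : ℝ → Prop} (hQ : ∀ᵐ t, Q t) {a : Fin d → ℝ}
    (ha : a ≠ 0) (b : ℝ) : ∀ᵐ x ∂μ, Q (a ⬝ᵥ x + b) := by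
  refine hμ.ae_le ?_
  obtain ⟨T, hTQ, hTm, hT⟩ := exists_measurable_superset_of_null hQ
  let L : (Fin d → ℝ) →ₗ[ℝ] ℝ := dotProductBilin ℝ ℝ a
  have hL : Function.Surjective L := by
    refine LinearMap.surjective_of_ne_zero fun h => ha ?_
    ext k
    have := LinearMap.congr_fun h (Pi.single k 1)
    simpa [L] using this
  have hs : MeasurableSet ((fun t : ℝ => t + b) ⁻¹' Tᶜ) :=
    hTm.compl.preimage (measurable_add_const b)
  have h1 : ∀ᵐ t : ℝ, t ∈ (fun t : ℝ => t + b) ⁻¹' Tᶜ :=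
    (measurePreserving_add_right volume b).quasiMeasurePreserving.ae
      (measure_eq_zero_iff_ae_notMem.1 hT)
  have h2 := (ae_comp_linearMap_mem_iff L volume volume hL hs).2 h1
  filter_upwards [h2] with x hx
  by_contra hcon
  exact hx (hTQ hcon)

variable [Fact (1 ≤ r)]

/-- The closed subspace of `L^r(μ)` spanned by the functions `x ↦ σ (a ⬝ᵥ x + b)`. -/
noncomputable def ridgeSpan {σ : ℝ → ℝ}
    (hσ : ∀ (a : Fin d → ℝ) (b : ℝ), MemLp (fun x => σ (a ⬝ᵥ x + b)) r μ) :
    Submodule ℝ (Lp ℝ r μ) :=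
  (Submodule.span ℝ (Set.range fun z : (Fin d → ℝ) × ℝ => (hσ z.1 z.2).toLp)).topologicalClosure

lemma toLp_mem_ridgeSpan {σ : ℝ → ℝ}
    (hσ : ∀ (a : Fin d → ℝ) (b : ℝ), MemLp (fun x => σ (a ⬝ᵥ x + b)) r μ) (a : Fin d → ℝ) (b : ℝ) :
    (hσ a b).toLp ∈ ridgeSpan hσ :=
  Submodule.le_topologicalClosure _ (Submodule.subset_span ⟨(a, b), rfl⟩)

/-- Mollifying `σ` does not lead out of the closed span of its ridge functions: the mollified
ridge function is an integral in `L^r(μ)` of multiples of translated ridge functions. -/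
theorem convolution_mem_ridgeSpan [IsProbabilityMeasure μ] (hr_top : r ≠ ∞) (hμ : μ ≪ volume)
    {K : Set (Fin d → ℝ)}
    (hK : IsCompact K) (hμK : ∀ᵐ x ∂μ, x ∈ K) {σ s : ℝ → ℝ}
    (hσ : ∀ (a : Fin d → ℝ) (b : ℝ), MemLp (fun x => σ (a ⬝ᵥ x + b)) r μ)
    (hs : Measurable s) (hsσ : ∀ᵐ t, s t = σ t)
    (hs_loc : ∀ t, ∃ U ∈ 𝓝 t, ∫⁻ u in U, ‖s u‖ₑ ^ r.toReal < ∞)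
    {φ : ℝ → ℝ} (hφ : Continuous φ) (hφc : HasCompactSupport φ) (a : Fin d → ℝ) (b : ℝ) :
    ∃ h : MemLp (fun x => (φ ⋆[ContinuousLinearMap.lsmul ℝ ℝ, volume] s) (a ⬝ᵥ x + b)) r μ,
      h.toLp ∈ ridgeSpan hσ := by
  have : Fact (r ≠ ∞) := ⟨hr_top⟩
  have hr0 : r ≠ 0 := (lt_of_lt_of_le one_pos (Fact.out : 1 ≤ r)).ne'
  have hr1 : 1 ≤ r.toReal := by
    simpa using ENNReal.toReal_mono hr_top (Fact.out : 1 ≤ r)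
  have hdot : Continuous fun x : Fin d → ℝ => a ⬝ᵥ x := by
    unfold dotProduct
    fun_prop
  -- the translates of `s` agree with those of `σ` in `L^r(μ)`, all of them if `a ≠ 0`, and
  -- almost all of them if `a = 0`
  have hsmem : ∀ b', MemLp (fun x => s (a ⬝ᵥ x + b')) r μ := by
    intro b'
    rcases eq_or_ne a 0 with rfl | ha
    · simpa using memLp_const (s b')
    · exact (memLp_congr_ae (ae_comp_affine hμ hsσ ha b')).2 (hσ a b')
  have hsV : ∀ᵐ y : ℝ, (hsmem (b - y)).toLp ∈ ridgeSpan hσ := by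
    have key : ∀ᵐ y : ℝ, ∀ᵐ x ∂μ, s (a ⬝ᵥ x + (b - y)) = σ (a ⬝ᵥ x + (b - y)) := by
      rcases eq_or_ne a 0 with rfl | ha
      · have := (Measure.measurePreserving_sub_left volume b).quasiMeasurePreserving.ae hsσ
        filter_upwards [this] with y hy
        simp [hy]
      · exact ae_of_all _ fun y => ae_comp_affine hμ hsσ ha _
    filter_upwards [key] with y hy
    rw [MemLp.toLp_congr _ (hσ a (b - y)) hy]
    exact toLp_mem_ridgeSpan hσ a (b - y)
  obtain ⟨R, hR⟩ := hφc.isCompact.isBounded.subset_closedBall 0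
  obtain ⟨M, hM⟩ := hφc.exists_bound_of_continuous hφ
  obtain ⟨R₀, hR₀⟩ := (hK.image hdot).isBounded.subset_closedBall (-b)
  set lam : Measure ℝ := volume.restrict (Metric.closedBall 0 R) with hlam
  have hlam_fin : IsFiniteMeasure lam := ⟨by
    rw [hlam, Measure.restrict_apply_univ]
    exact (isCompact_closedBall 0 R).measure_lt_top⟩
  let G₀ : ℝ × (Fin d → ℝ) → ℝ := fun z => s (a ⬝ᵥ z.2 + (b - z.1))
  have hG₀ : Measurable G₀ := hs.comp
    ((hdot.measurable.comp measurable_snd).add (measurable_const.sub measurable_fst))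
  let G : ℝ × (Fin d → ℝ) → ℝ := fun z => φ z.1 * G₀ z
  have hG : Measurable G := (hφ.measurable.comp measurable_fst).mul hG₀
  have hGm : ∀ y, MemLp (fun x => G (y, x)) r μ := fun y => (hsmem (b - y)).const_mul (φ y)
  have hGV : ∀ᵐ y ∂lam, (hGm y).toLp ∈ ridgeSpan hσ := by
    filter_upwards [ae_restrict_of_ae hsV] with y hy
    have : (hGm y).toLp = φ y • (hsmem (b - y)).toLp := by
      rw [← MemLp.toLp_const_smul]
      rfl
    rw [this]
    exact Submodule.smul_mem _ _ hy
  have hfin : ∫⁻ y, eLpNorm (fun x => G₀ (y, x)) r μ ∂lam < ∞ := by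
    have hC : ∫⁻ u in Metric.closedBall 0 (R₀ + R), ‖s u‖ₑ ^ r.toReal < ∞ :=
      setLIntegral_lt_top_of_isCompact_of_nhds hs_loc (isCompact_closedBall _ _)
    have hpow : Measurable fun z => ‖G₀ z‖ₑ ^ r.toReal := hG₀.enorm.pow_const _
    calc ∫⁻ y, eLpNorm (fun x => G₀ (y, x)) r μ ∂lam
        ≤ ∫⁻ y, (1 + ∫⁻ x, ‖G₀ (y, x)‖ₑ ^ r.toReal ∂μ) ∂lam := by
          refine lintegral_mono fun y => ?_
          rw [eLpNorm_eq_lintegral_rpow_enorm_toReal hr0 hr_top]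
          exact ENNReal.rpow_inv_le_one_add _ hr1
      _ = lam Set.univ + ∫⁻ x, ∫⁻ y, ‖G₀ (y, x)‖ₑ ^ r.toReal ∂lam ∂μ := by
          rw [lintegral_add_left measurable_const, lintegral_one,
            lintegral_lintegral_swap hpow.aemeasurable]
      _ ≤ lam Set.univ + ∫⁻ _x, (∫⁻ u in Metric.closedBall 0 (R₀ + R), ‖s u‖ₑ ^ r.toReal) ∂μ := by
          refine add_le_add le_rfl (lintegral_mono_ae ?_)
          filter_upwards [hμK] with x hx
          have hx' := hR₀ (Set.mem_image_of_mem _ hx)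
          rw [mem_closedBall_iff_norm, sub_neg_eq_add] at hx'
          rw [hlam, ← lintegral_indicator measurableSet_closedBall,
            ← lintegral_indicator measurableSet_closedBall,
            ← lintegral_sub_left_eq_self (Set.indicator _ fun u => ‖s u‖ₑ ^ r.toReal)
              (a ⬝ᵥ x + b)]
          refine lintegral_mono fun y => ?_
          by_cases hy : y ∈ Metric.closedBall (0 : ℝ) R
          · rw [Set.indicator_of_mem hy, Set.indicator_of_mem]
            · simp only [G₀, add_sub_assoc]
              exact le_rfl
            · rw [mem_closedBall_zero_iff] at hy ⊢
              exact (norm_sub_le _ _).trans (add_le_add hx' hy)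
          · simp [Set.indicator_of_notMem hy]
      _ < ∞ := by
          rw [lintegral_const, measure_univ (μ := μ), mul_one]
          exact ENNReal.add_lt_top.2 ⟨measure_lt_top _ _, hC⟩
  have hint : Integrable (fun y => (hGm y).toLp) lam := by
    refine ⟨(stronglyMeasurable_toLp_section hG hGm).aestronglyMeasurable, ?_⟩
    calc ∫⁻ y, ‖(hGm y).toLp‖ₑ ∂lam
        ≤ ∫⁻ y, ENNReal.ofReal M * eLpNorm (fun x => G₀ (y, x)) r μ ∂lam := by
          refine lintegral_mono fun y => ?_
          rw [Lp.enorm_toLp]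
          change eLpNorm (φ y • fun x => G₀ (y, x)) r μ ≤ _
          rw [eLpNorm_const_smul, ← ofReal_norm]
          gcongr
          exact hM y
      _ = ENNReal.ofReal M * ∫⁻ y, eLpNorm (fun x => G₀ (y, x)) r μ ∂lam :=
          lintegral_const_mul _ (measurable_eLpNorm_section hr0 hr_top hG₀)
      _ < ∞ := ENNReal.mul_lt_top ENNReal.ofReal_lt_top hfin
  have hmem := Submodule.integral_mem_of_isClosed
    (Submodule.isClosed_topologicalClosure _) hint hGV
  have hcoe : (∫ y, (hGm y).toLp ∂lam : Lp ℝ r μ) =ᵐ[μ]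
      fun x => (φ ⋆[ContinuousLinearMap.lsmul ℝ ℝ, volume] s) (a ⬝ᵥ x + b) := by
    refine (coeFn_integral_toLp hG hGm hint).trans (ae_of_all _ fun x => ?_)
    simp only [convolution_def, ContinuousLinearMap.lsmul_apply, smul_eq_mul, G, G₀, hlam,
      add_sub_assoc]
    refine setIntegral_eq_integral_of_forall_compl_eq_zero fun y hy => ?_
    rw [image_eq_zero_of_notMem_tsupport fun h => hy (hR h), zero_mul]
  have hψ := (memLp_congr_ae hcoe).1 (Lp.memLp _)
  refine ⟨hψ, ?_⟩
  have : hψ.toLp = ∫ y, (hGm y).toLp ∂lam := Lp.ext (hψ.coeFn_toLp.trans hcoe.symm)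
  rw [this]
  exact hmem

end

/-! ### Derivatives and exponentials in spaces of continuous functions -/

section
open Filter Topology
open scoped ContDiff

variable {X : Type*} [TopologicalSpace X] [CompactSpace X]

/-- The function `x ↦ g (t * f x + b) * h x` as a continuous function of `x`. -/
def ridgeMul (f h : C(X, ℝ)) {g : ℝ → ℝ} (hg : Continuous g) (b t : ℝ) : C(X, ℝ) :=
  ⟨fun x => g (t * f x + b) * h x, by fun_prop⟩

/-- The derivative in `t` exists in the supremum norm, since by the fundamental theorem of calculus
the difference quotients are averages of a continuous curve in `C(X, ℝ)`. -/
lemma hasDerivAt_ridgeMul (f h : C(X, ℝ)) {g : ℝ → ℝ} (hg : ContDiff ℝ 1 g) (b t : ℝ) :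
    HasDerivAt (ridgeMul f h hg.continuous b)
      (ridgeMul f (f * h) (hg.continuous_deriv le_rfl) b t) t := by
  have hg' : Continuous (deriv g) := hg.continuous_deriv le_rfl
  let γ : ℝ → C(X, ℝ) := ridgeMul f (f * h) hg' b
  have hγ : Continuous γ := by
    refine ContinuousMap.continuous_of_continuous_uncurry _ ?_
    change Continuous fun z : ℝ × X => deriv g (z.1 * f z.2 + b) * (f z.2 * h z.2)
    fun_prop
  have hFTC : ridgeMul f h hg.continuous b =
      fun u => ridgeMul f h hg.continuous b 0 + ∫ τ in (0 : ℝ)..u, γ τ := by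
    funext u
    ext x
    have h1 : (∫ τ in (0 : ℝ)..u, γ τ) x = ∫ τ in (0 : ℝ)..u, γ τ x :=
      ((ContinuousMap.evalCLM ℝ x).intervalIntegral_comp_comm
        (hγ.intervalIntegrable 0 u)).symm
    have h2 : ∀ τ, HasDerivAt (fun τ => g (τ * f x + b) * h x) (γ τ x) τ := by
      intro τ
      have hin : HasDerivAt (fun τ => τ * f x + b) (f x) τ := by
        simpa using ((hasDerivAt_id τ).mul_const (f x)).add_const b
      have hgd : HasDerivAt g (deriv g (τ * f x + b)) (τ * f x + b) :=
        (hg.differentiable one_ne_zero _).hasDerivAt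
      refine ((hgd.comp τ hin).mul_const (h x)).congr_deriv ?_
      simp only [γ, ridgeMul, ContinuousMap.coe_mk, ContinuousMap.mul_apply]
      ring
    have h3 : Continuous fun τ => γ τ x := (ContinuousMap.evalCLM ℝ x).continuous.comp hγ
    rw [ContinuousMap.add_apply, h1,
      intervalIntegral.integral_eq_sub_of_hasDerivAt (fun τ _ => h2 τ) (h3.intervalIntegrable 0 u)]
    simp [ridgeMul]
  rw [hFTC]
  exact (hγ.integral_hasStrictDerivAt 0 t).hasDerivAt.const_add _

/-- A closed subspace that contains all `ψ (t * f + b)` contains their derivatives in `t`; the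
derivative of order `k` at `t = 0` is a multiple of `f ^ k`. -/
theorem iteratedDeriv_smul_pow_mem {U : Submodule ℝ C(X, ℝ)} (hU : IsClosed (U : Set C(X, ℝ)))
    (f : C(X, ℝ)) {ψ : ℝ → ℝ} (hψ : ContDiff ℝ ∞ ψ) (b : ℝ)
    (h : ∀ t, ∃ F ∈ U, ∀ x, F x = ψ (t * f x + b)) (k : ℕ) :
    iteratedDeriv k ψ b • f ^ k ∈ U := by
  have hk : ∀ k : ℕ, ContDiff ℝ 1 (iteratedDeriv k ψ) := fun k => by
    rw [iteratedDeriv_eq_iterate]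
    exact (ContDiff.iterate_deriv k hψ).of_le (by exact_mod_cast le_top)
  have key : ∀ k t, ridgeMul f (f ^ k) (hk k).continuous b t ∈ U := by
    intro k
    induction k with
    | zero =>
      intro t
      obtain ⟨F, hF, hFx⟩ := h t
      convert hF using 1
      ext x
      simp [ridgeMul, hFx]
    | succ k ih =>
      intro t
      have hd := hasDerivAt_ridgeMul f (f ^ k) (hk k) b t
      have hlim := hasDerivAt_iff_tendsto_slope.1 hd
      have hmem := hU.mem_of_tendsto hlim (Eventually.of_forall fun u =>
        U.smul_mem _ (U.sub_mem (ih u) (ih t)))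
      convert SetLike.mem_coe.1 hmem using 1
      ext x
      simp [ridgeMul, iteratedDeriv_succ, pow_succ']
  convert key k 0 using 1
  ext x
  simp [ridgeMul]

end

section

variable {d : ℕ}

/-- The linear functional `x ↦ a ⬝ᵥ x` on `K`. -/
def dotMap (K : Set (Fin d → ℝ)) (a : Fin d → ℝ) : C(K, ℝ) :=
  ⟨fun x => a ⬝ᵥ (x : Fin d → ℝ), continuous_finsetSum _ fun k _ =>
    continuous_const.mul ((continuous_apply k).comp continuous_subtype_val)⟩

/-- The exponentials of linear functionals span a dense algebra by the Stone–Weierstrass theorem,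
and they are limits of combinations of powers of linear functionals. -/
theorem eq_top_of_dotMap_pow_mem {K : Set (Fin d → ℝ)} [CompactSpace K]
    {U : Submodule ℝ C(K, ℝ)} (hU : IsClosed (U : Set C(K, ℝ)))
    (h : ∀ a k, dotMap K a ^ k ∈ U) : U = ⊤ := by
  let e : (Fin d → ℝ) → C(K, ℝ) := fun a => ⟨fun x => Real.exp (dotMap K a x), by fun_prop⟩
  have he : ∀ a, e a ∈ U := by
    intro a
    have hs := NormedSpace.exp_series_hasSum_exp' (𝕂 := ℝ) (dotMap K a)
    have : NormedSpace.exp (dotMap K a) = e a := by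
      ext x
      have h1 := (ContinuousMap.evalCLM ℝ x).hasSum hs
      have h2 := NormedSpace.exp_series_hasSum_exp' (𝕂 := ℝ) (dotMap K a x)
      rw [← Real.exp_eq_exp_ℝ] at h2
      exact h1.unique (by simpa [e] using h2)
    rw [← this]
    exact hU.mem_of_tendsto hs (Filter.Eventually.of_forall fun s =>
      U.sum_mem fun k _ => U.smul_mem _ (h a k))
  let M : Submonoid C(K, ℝ) :=
    { carrier := Set.range e
      one_mem' := ⟨0, by ext x; simp [e, dotMap]⟩
      mul_mem' := by
        rintro _ _ ⟨a, rfl⟩ ⟨a', rfl⟩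
        exact ⟨a + a', by ext x; simp [e, dotMap, add_dotProduct, Real.exp_add]; rfl⟩ }
  let A : Subalgebra ℝ C(K, ℝ) := Algebra.adjoin ℝ (Set.range e)
  have hAU : (A : Set C(K, ℝ)) ⊆ U := by
    have h1 : Subalgebra.toSubmodule A = Submodule.span ℝ (Submonoid.closure (Set.range e)) :=
      Algebra.adjoin_eq_span ..
    have h2 : Subalgebra.toSubmodule A ≤ U := by
      rw [h1, Submodule.span_le]
      intro f hf
      obtain ⟨a, rfl⟩ := (Submonoid.closure_le (S := M)).2 le_rfl hf
      exact he a
    exact h2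
  have hsep : A.SeparatesPoints := by
    intro x y hxy
    have : ∃ k, (x : Fin d → ℝ) k ≠ (y : Fin d → ℝ) k := by
      by_contra! hcon
      exact hxy (Subtype.ext (funext hcon))
    obtain ⟨k, hk⟩ := this
    refine ⟨_, ⟨e (Pi.single k 1), Algebra.subset_adjoin ⟨_, rfl⟩, rfl⟩, ?_⟩
    simpa [e, dotMap] using hk
  have htop := ContinuousMap.subalgebra_topologicalClosure_eq_top_of_separatesPoints A hsep
  rw [eq_top_iff]
  intro f _
  have hf : f ∈ A.topologicalClosure := by
    rw [htop]
    exact Algebra.mem_top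
  exact closure_minimal hAU hU hf

end

/-! ### Density of ridge functions -/

section
open scoped Convolution Topology

variable {d : ℕ} {μ : Measure (Fin d → ℝ)} {r : ℝ≥0∞} [Fact (1 ≤ r)]

/-- Continuous functions on a compact set of full measure define elements of `L^r(μ)`. -/
lemma exists_toLp_clm [IsProbabilityMeasure μ] {K : Set (Fin d → ℝ)} [CompactSpace K]
    (hK : MeasurableSet K)     (hμK : ∀ᵐ x ∂μ, x ∈ K) :
    ∃ J : C(K, ℝ) →L[ℝ] Lp ℝ r μ, ∀ (f : C(K, ℝ)) (F : (Fin d → ℝ) → ℝ) (hF : MemLp F r μ),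
      (∀ x : K, F x = f x) → J f = hF.toLp := by
  let ext : C(K, ℝ) → (Fin d → ℝ) → ℝ := fun f => Function.extend Subtype.val f 0
  have hext : ∀ f (x : K), ext f x = f x := fun f x =>
    Subtype.val_injective.extend_apply (f : K → ℝ) 0 x
  have hbd : ∀ f, ∀ᵐ x ∂μ, ‖ext f x‖ ≤ ‖f‖ := fun f => by
    filter_upwards [hμK] with x hx
    rw [hext f ⟨x, hx⟩]
    exact f.norm_coe_le_norm _
  have hmem : ∀ f, MemLp (ext f) r μ := fun f =>
    MemLp.of_bound ((MeasurableEmbedding.subtype_coe hK).measurable_extend f.continuous.measurable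
      measurable_const).aestronglyMeasurable ‖f‖ (hbd f)
  let J : C(K, ℝ) →ₗ[ℝ] Lp ℝ r μ :=
    { toFun := fun f => (hmem f).toLp
      map_add' := fun f g => by
        rw [← MemLp.toLp_add]
        refine MemLp.toLp_congr _ _ ?_
        filter_upwards [hμK] with x hx
        simp [hext _ ⟨x, hx⟩]
      map_smul' := fun c f => by
        rw [RingHom.id_apply, ← MemLp.toLp_const_smul]
        refine MemLp.toLp_congr _ _ ?_
        filter_upwards [hμK] with x hx
        simp [hext _ ⟨x, hx⟩] }
  refine ⟨J.mkContinuous 1 fun f => ?_, fun f F hF h => ?_⟩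
  · have h1 : ∀ᵐ x ∂μ, ‖(hmem f).toLp (ext f) x‖ ≤ ‖f‖ := by
      filter_upwards [hbd f, (hmem f).coeFn_toLp] with x hx hx'
      rwa [hx']
    change ‖(hmem f).toLp (ext f)‖ ≤ 1 * ‖f‖
    refine (Lp.norm_le_of_ae_bound (norm_nonneg f) h1).trans (le_of_eq ?_)
    simp [measureUnivNNReal]
  · refine MemLp.toLp_congr (hmem f) hF ?_
    filter_upwards [hμK] with x hx
    rw [hext f ⟨x, hx⟩, ← h ⟨x, hx⟩]

/-- In dimension zero all functions are constant, and one nonzero value of `σ` suffices. -/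
lemma ridgeSpan_eq_top_of_dim_eq_zero [IsEmpty (Fin d)] {σ : ℝ → ℝ}
    (hσ : ∀ (a : Fin d → ℝ) (b : ℝ), MemLp (fun x => σ (a ⬝ᵥ x + b)) r μ)
    (hσ_poly : ¬ ∃ Q : Polynomial ℝ, ∀ᵐ t ∂(volume : Measure ℝ), σ t = Q.eval t) :
    ridgeSpan hσ = ⊤ := by
  have hb : ∃ b, σ b ≠ 0 := by
    by_contra! hcon
    exact hσ_poly ⟨0, ae_of_all _ fun t => by simp [hcon t]⟩
  obtain ⟨b, hb⟩ := hb
  rw [eq_top_iff]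
  intro f _
  have : f = (f 0 / σ b) • (hσ 0 b).toLp := by
    rw [← MemLp.toLp_const_smul]
    refine Lp.ext ?_
    filter_upwards [((hσ 0 b).const_smul (f 0 / σ b)).coeFn_toLp] with x hx
    rw [hx, Subsingleton.elim x 0]
    simp [hb]
  rw [this]
  exact Submodule.smul_mem _ _ (toLp_mem_ridgeSpan hσ 0 b)

/-- Universal approximation: the ridge functions `x ↦ σ (a ⬝ᵥ x + b)` span a dense subspace
of `L^r(μ)` unless `σ` is almost everywhere a polynomial. -/
theorem ridgeSpan_eq_top [IsProbabilityMeasure μ] (hr_top : r ≠ ∞) (hμ : μ ≪ volume)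
    {K : Set (Fin d → ℝ)}
    (hK : IsCompact K) (hμK : ∀ᵐ x ∂μ, x ∈ K) {σ : ℝ → ℝ} (hσ_meas : AEMeasurable σ volume)
    (hσ : ∀ (a : Fin d → ℝ) (b : ℝ), MemLp (fun x => σ (a ⬝ᵥ x + b)) r μ)
    (hσ_poly : ¬ ∃ Q : Polynomial ℝ, ∀ᵐ t ∂(volume : Measure ℝ), σ t = Q.eval t) :
    ridgeSpan hσ = ⊤ := by
  rcases isEmpty_or_nonempty (Fin d) with hd | ⟨⟨k₀⟩⟩
  · exact ridgeSpan_eq_top_of_dim_eq_zero hσ hσ_poly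
  have hr0 : r ≠ 0 := (lt_of_lt_of_le one_pos (Fact.out : 1 ≤ r)).ne'
  have hr1 : 1 ≤ r.toReal := by
    simpa using ENNReal.toReal_mono hr_top (Fact.out : 1 ≤ r)
  obtain ⟨s, hs, hσs⟩ := hσ_meas
  have hsσ : ∀ᵐ t, s t = σ t := hσs.symm
  have hs_loc : ∀ t, ∃ U ∈ 𝓝 t, ∫⁻ u in U, ‖s u‖ₑ ^ r.toReal < ∞ := by
    have heval : Measurable fun x : Fin d → ℝ => x k₀ := measurable_pi_apply k₀
    have hprob : IsProbabilityMeasure (μ.map fun x : Fin d → ℝ => x k₀) :=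
      Measure.isProbabilityMeasure_map heval.aemeasurable
    have hν : μ.map (fun x : Fin d → ℝ => x k₀) ≪ volume :=
      (hμ.map heval).trans
        (Measure.quasiMeasurePreserving_eval (fun _ : Fin d => (volume : Measure ℝ)) k₀).2
    refine exists_nhds_setLIntegral_lt_top_of_translates (hs.enorm.pow_const _) hν fun b => ?_
    have hsb : Measurable fun t => ‖s (t + b)‖ₑ ^ r.toReal :=
      (hs.comp (measurable_add_const b)).enorm.pow_const _
    rw [lintegral_map hsb heval]
    have hne : (Pi.single k₀ 1 : Fin d → ℝ) ≠ 0 := by simp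
    have h1 : (fun x => σ ((Pi.single k₀ 1 : Fin d → ℝ) ⬝ᵥ x + b)) =ᵐ[μ] fun x => s (x k₀ + b) := by
      filter_upwards [ae_comp_affine hμ hsσ hne b] with x hx
      rw [← hx]
      simp
    have h2 := (memLp_congr_ae h1).1 (hσ _ b)
    exact lintegral_rpow_enorm_lt_top_of_eLpNorm_lt_top hr0 hr_top h2.2
  have hs_int : LocallyIntegrable s volume := by
    intro t
    obtain ⟨U, hU, hlt⟩ := hs_loc t
    refine ⟨U ∩ Metric.closedBall t 1,
      Filter.inter_mem hU (Metric.closedBall_mem_nhds t one_pos), ?_⟩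
    refine ⟨hs.aestronglyMeasurable, ?_⟩
    calc ∫⁻ u in U ∩ Metric.closedBall t 1, ‖s u‖ₑ
        ≤ ∫⁻ u in U ∩ Metric.closedBall t 1, (1 + ‖s u‖ₑ ^ r.toReal) := by
          refine lintegral_mono fun u => ?_
          have := ENNReal.rpow_inv_le_one_add (‖s u‖ₑ ^ r.toReal) hr1
          rwa [← ENNReal.rpow_mul, mul_one_div_cancel (by positivity), ENNReal.rpow_one] at this
      _ = volume (U ∩ Metric.closedBall t 1) +
          ∫⁻ u in U ∩ Metric.closedBall t 1, ‖s u‖ₑ ^ r.toReal := by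
          rw [lintegral_add_left measurable_const, lintegral_one, Measure.restrict_apply_univ]
      _ < ∞ := ENNReal.add_lt_top.2
          ⟨(measure_mono Set.inter_subset_right).trans_lt (isCompact_closedBall t 1).measure_lt_top,
            (lintegral_mono_set Set.inter_subset_left).trans_lt hlt⟩
  have hs_poly : ¬ ∃ Q : Polynomial ℝ, ∀ᵐ t ∂(volume : Measure ℝ), s t = Q.eval t := by
    rintro ⟨Q, hQ⟩
    refine hσ_poly ⟨Q, ?_⟩
    filter_upwards [hQ, hsσ] with t h1 h2
    rw [← h2, h1]
  have hVc : IsClosed (ridgeSpan hσ : Set (Lp ℝ r μ)) := Submodule.isClosed_topologicalClosure _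
  have hKc : CompactSpace K := isCompact_iff_compactSpace.1 hK
  obtain ⟨J, hJ⟩ := exists_toLp_clm (μ := μ) (r := r) hK.measurableSet hμK
  have hU : (ridgeSpan hσ).comap (J : C(K, ℝ) →ₗ[ℝ] Lp ℝ r μ) = ⊤ := by
    have hUc : IsClosed ((ridgeSpan hσ).comap (J : C(K, ℝ) →ₗ[ℝ] Lp ℝ r μ) : Set C(K, ℝ)) :=
      hVc.preimage J.continuous
    refine eq_top_of_dotMap_pow_mem hUc fun a k => ?_
    obtain ⟨φ, hφ, hφc, b, hb⟩ := exists_convolution_iteratedDeriv_ne_zero hs_int hs_poly k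
    have hψ : ContDiff ℝ ((⊤ : ℕ∞) : WithTop ℕ∞) (φ ⋆[ContinuousLinearMap.lsmul ℝ ℝ, volume] s) :=
      hφc.contDiff_convolution_left (n := ⊤) _ hφ hs_int
    have hmem := iteratedDeriv_smul_pow_mem hUc (dotMap K a) hψ b (fun t => ?_) k
    · have := Submodule.smul_mem _
        (iteratedDeriv k (φ ⋆[ContinuousLinearMap.lsmul ℝ ℝ, volume] s) b)⁻¹ hmem
      rwa [smul_smul, inv_mul_cancel₀ hb, one_smul] at this
    · obtain ⟨hF, hFV⟩ := convolution_mem_ridgeSpan hr_top hμ hK hμK hσ hs hsσ hs_loc hφ.continuous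
        hφc (t • a) b
      refine ⟨⟨fun x => (φ ⋆[ContinuousLinearMap.lsmul ℝ ℝ, volume] s) (t * dotMap K a x + b),
        hψ.continuous.comp (by fun_prop)⟩, ?_, fun x => rfl⟩
      rw [Submodule.mem_comap, ContinuousLinearMap.coe_coe, hJ _ _ hF]
      · exact hFV
      · intro x
        simp only [smul_dotProduct, smul_eq_mul]
        rfl
  have hdense := BoundedContinuousFunction.toLp_denseRange ℝ μ ℝ (p := r) hr_top
  rw [eq_top_iff]
  intro f _
  refine closure_minimal ?_ hVc (hdense f)
  rintro _ ⟨g, rfl⟩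
  have hgK : J (g.toContinuousMap.restrict K) ∈ ridgeSpan hσ := by
    have : g.toContinuousMap.restrict K ∈
        (ridgeSpan hσ).comap (J : C(K, ℝ) →ₗ[ℝ] Lp ℝ r μ) := by
      rw [hU]
      exact Submodule.mem_top
    exact this
  rw [hJ _ g (MemLp.of_bound g.continuous.aestronglyMeasurable ‖g‖
    (ae_of_all _ g.norm_coe_le_norm)) (fun x => rfl)] at hgK
  exact hgK

end

/-! ### Expected nodes -/

section

variable {d : ℕ} {μ : Measure (Fin d → ℝ)} {r : ℝ≥0∞} {σ : ℝ → ℝ}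

lemma memLp_expectedNode
    (hσ : ∀ (a : Fin d → ℝ) (b : ℝ), MemLp (fun x => σ (a ⬝ᵥ x + b)) r μ)
    (θ : (Fin d → Bool) → ℝ) (a : Fin d → ℝ) (b : ℝ) :
    MemLp (fun x => ∑ S, θ S * σ (mask S a ⬝ᵥ x + b)) r μ :=
  memLp_finsetSum Finset.univ (f := fun S x => θ S * σ (mask S a ⬝ᵥ x + b)) fun S _ =>
    (hσ (mask S a) b).const_mul (θ S)

/-- The ridge functions are combinations of expected nodes, by induction on the number of nonzero
weights: in the expected node with weights `a`, the ridge function with weights `a` has a positive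
coefficient, and all other ridge functions have fewer nonzero weights. -/
theorem toLp_mem_span_expectedNode [Fact (1 ≤ r)]
    (hσ : ∀ (a : Fin d → ℝ) (b : ℝ), MemLp (fun x => σ (a ⬝ᵥ x + b)) r μ)
    {θ : (Fin d → Bool) → ℝ} (hθ₀ : ∀ S, 0 ≤ θ S) (hθ : 0 < θ fun _ => true)
    (a : Fin d → ℝ) (b : ℝ) :
    (hσ a b).toLp ∈ Submodule.span ℝ (Set.range fun z : (Fin d → ℝ) × ℝ =>
      (memLp_expectedNode hσ θ z.1 z.2).toLp) := by
  classical
  set W := Submodule.span ℝ (Set.range fun z : (Fin d → ℝ) × ℝ =>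
    (memLp_expectedNode hσ θ z.1 z.2).toLp) with hW
  induction hn : (Finset.univ.filter fun k => a k ≠ 0).card using Nat.strong_induction_on
    generalizing a with
  | _ n ih =>
    have hT : (memLp_expectedNode hσ θ a b).toLp = ∑ S, θ S • (hσ (mask S a) b).toLp := by
      refine Lp.ext ?_
      have h1 : ∀ᵐ x ∂μ, ∀ S, (hσ (mask S a) b).toLp _ x = σ (mask S a ⬝ᵥ x + b) :=
        ae_all_iff.2 fun S => (hσ (mask S a) b).coeFn_toLp
      have h2 : ∀ᵐ x ∂μ, ∀ S, (θ S • (hσ (mask S a) b).toLp : Lp ℝ r μ) x =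
          θ S * (hσ (mask S a) b).toLp _ x := ae_all_iff.2 fun S => Lp.coeFn_smul _ _
      filter_upwards [(memLp_expectedNode hσ θ a b).coeFn_toLp, h1, h2,
        Lp.coeFn_finsetSum Finset.univ fun S => θ S • (hσ (mask S a) b).toLp] with x hx h1 h2 h3
      rw [hx, h3, Finset.sum_apply]
      simp only [h1, h2]
    have hTW : (memLp_expectedNode hσ θ a b).toLp ∈ W := Submodule.subset_span ⟨(a, b), rfl⟩
    have hsplit := Finset.sum_filter_add_sum_filter_not Finset.univ (fun S => mask S a = a)
      fun S => θ S • (hσ (mask S a) b).toLp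
    have hsame : ∑ S with mask S a = a, θ S • (hσ (mask S a) b).toLp =
        (∑ S with mask S a = a, θ S) • (hσ a b).toLp := by
      rw [Finset.sum_smul]
      refine Finset.sum_congr rfl fun S hS => ?_
      have hSa : mask S a = a := (Finset.mem_filter.1 hS).2
      simp only [hSa]
    have hrest : ∑ S with ¬ mask S a = a, θ S • (hσ (mask S a) b).toLp ∈ W := by
      refine W.sum_mem fun S hS => W.smul_mem _ (ih _ ?_ (mask S a) rfl)
      rw [← hn]
      refine Finset.card_lt_card (Finset.ssubset_iff_subset_ne.2 ⟨fun k hk => ?_, fun heq => ?_⟩)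
      · simp only [mask, Finset.mem_filter, Finset.mem_univ, true_and] at hk ⊢
        intro h
        simp [h] at hk
      · refine (Finset.mem_filter.1 hS).2 (funext fun k => ?_)
        by_contra hne
        have hak : a k ≠ 0 := by
          rintro h
          simp [mask, h] at hne
        have hk := (Finset.ext_iff.1 heq k).2 (by simp [hak])
        simp only [mask] at hk hne
        split_ifs at hk hne with hSk
        · exact hne rfl
        · exact hSk (by simpa using hk : S k = true ∧ ¬a k = 0).1
    have hpos : 0 < ∑ S with mask S a = a, θ S :=
      lt_of_lt_of_le hθ (Finset.single_le_sum (f := θ) (fun S _ => hθ₀ S)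
        (Finset.mem_filter.2 ⟨Finset.mem_univ _, by ext k; simp [mask]⟩))
    rw [← hT, hsame] at hsplit
    have hmem : (∑ S with mask S a = a, θ S) • (hσ a b).toLp ∈ W := by
      rw [eq_sub_of_add_eq hsplit]
      exact W.sub_mem hTW hrest
    exact (W.smul_mem_iff hpos.ne').1 hmem

/-- Every function in `L^r(μ)` is close to a combination of expected nodes. -/
lemma exists_expected_combination [Fact (1 ≤ r)]
    (hσ : ∀ (a : Fin d → ℝ) (b : ℝ), MemLp (fun x => σ (a ⬝ᵥ x + b)) r μ)
    (hdense : ridgeSpan hσ = ⊤)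
    {θ : (Fin d → Bool) → ℝ} (hθ₀ : ∀ S, 0 ≤ θ S) (hθ : 0 < θ fun _ => true)
    {ζ : (Fin d → ℝ) → ℝ} (hζ : MemLp ζ r μ) {ε : ℝ} (hε : 0 < ε) :
    ∃ I : Finset ((Fin d → ℝ) × ℝ), ∃ c : (Fin d → ℝ) × ℝ → ℝ,
      eLpNorm (fun x => ∑ i : I, c i * ∑ S, θ S * σ (mask S i.1.1 ⬝ᵥ x + i.1.2) - ζ x) r μ ≤
        ENNReal.ofReal ε := by
  set v : (Fin d → ℝ) × ℝ → Lp ℝ r μ := fun z => (memLp_expectedNode hσ θ z.1 z.2).toLp with hv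
  have hcl : hζ.toLp ∈ (Submodule.span ℝ (Set.range v)).topologicalClosure := by
    have hle : ridgeSpan hσ ≤ (Submodule.span ℝ (Set.range v)).topologicalClosure := by
      refine Submodule.topologicalClosure_mono (Submodule.span_le.2 ?_)
      rintro _ ⟨z, rfl⟩
      exact toLp_mem_span_expectedNode hσ hθ₀ hθ z.1 z.2
    rw [hdense] at hle
    exact hle Submodule.mem_top
  obtain ⟨f, hf, hdist⟩ := Metric.mem_closure_iff.1 hcl ε hε
  obtain ⟨c, rfl⟩ := Finsupp.mem_span_range_iff_exists_finsupp.1 hf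
  refine ⟨c.support, c, ?_⟩
  have hae : (c.sum fun z t => t • v z : Lp ℝ r μ) =ᵐ[μ]
      fun x => ∑ i : c.support, c i * ∑ S, θ S * σ (mask S i.1.1 ⬝ᵥ x + i.1.2) := by
    have h1 : ∀ᵐ x ∂μ, ∀ i : c.support,
        v i x = ∑ S, θ S * σ (mask S i.1.1 ⬝ᵥ x + i.1.2) :=
      ae_all_iff.2 fun i => (memLp_expectedNode hσ θ i.1.1 i.1.2).coeFn_toLp
    have h2 : ∀ᵐ x ∂μ, ∀ i : c.support, (c i • v i : Lp ℝ r μ) x = c i * v i x :=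
      ae_all_iff.2 fun i => Lp.coeFn_smul _ _
    filter_upwards [h1, h2, Lp.coeFn_finsetSum c.support fun z => c z • v z] with x h1 h2 h3
    rw [Finsupp.sum, h3, Finset.sum_apply, ← Finset.sum_coe_sort]
    simp only [h2, h1]
  have hnorm : eLpNorm (fun x => ∑ i : c.support, c i * ∑ S, θ S *
      σ (mask S i.1.1 ⬝ᵥ x + i.1.2) - ζ x) r μ = edist (c.sum fun z t => t • v z) hζ.toLp := by
    rw [Lp.edist_def]
    exact eLpNorm_congr_ae (hae.sub hζ.coeFn_toLp).symm
  rw [hnorm, edist_dist, dist_comm]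
  exact ENNReal.ofReal_le_ofReal hdist.le

end

/-! ### Approximation by networks with dropout -/

/-- The approximation theorem for every kind of filter that treats the nodes alike and keeps all
weights of a node with positive probability. -/
theorem exists_network_of_isNodewiseFilter {d : ℕ} {μ : Measure (Fin d → ℝ)}
    {r : ℝ≥0∞} [Fact (1 ≤ r)] {σ : ℝ → ℝ}
    (hσ : ∀ (a : Fin d → ℝ) (b : ℝ), MemLp (fun x => σ (a ⬝ᵥ x + b)) r μ)
    (hdense : ridgeSpan hσ = ⊤)
    {θ : (Fin d → Bool) → ℝ} (hθ₀ : ∀ S, 0 ≤ θ S) (hθ₁ : ∀ S, θ S ≤ 1) (hθ : 0 < θ fun _ => true)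
    {q : ℝ} (hq : 1 ≤ q) {ζ : (Fin d → ℝ) → ℝ} (hζ : MemLp ζ r μ) {ε : ℝ} (hε : 0 < ε) :
    ∃ (N : ℕ) (w : ParamIdx d N → ℝ), (∀ i, w (.inr (.inr i)) = 0) ∧
      ∀ (Ω : Type*) [MeasurableSpace Ω] (P : Measure Ω) [IsProbabilityMeasure P]
        (g : Ω → ParamIdx d N → Bool), IsNodewiseFilter P θ g →
        ApproxInProbAndLq μ r q ε P (fun ω => network σ (filtered w (g ω))) ζ := by
  obtain ⟨I, c, hI⟩ := exists_expected_combination hσ hdense hθ₀ hθ hζ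
    (show 0 < ε / 4 by positivity)
  exact exists_network_of_expected_combination Fact.out hσ hθ₀ hθ₁ hq hζ hε
    (fun i : I => c i) (fun i => i.1.1) (fun i => i.1.2) hI

theorem mainTheorem5 (d : ℕ) (μ : Measure (Fin d → ℝ)) [IsProbabilityMeasure μ]
    (hμ_compact : IsCompact μ.support) (hμ_ac : μ ≪ volume)
    (r : ℝ≥0∞) (hr : 1 ≤ r) (hr_top : r ≠ ∞)
    (σ : ℝ → ℝ) (hσ_meas : AEMeasurable σ volume)
    (hσ_Lr : ∀ (a : Fin d → ℝ) (b : ℝ), MemLp (fun x => σ (a ⬝ᵥ x + b)) r μ)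
    (hσ_poly : ¬ ∃ Q : Polynomial ℝ, ∀ᵐ t ∂(volume : Measure ℝ), σ t = Q.eval t)
    (p : ℝ) (hp : 0 ≤ p) (hp_lt : p < 1) (q : ℝ) (hq : 1 ≤ q)
    (ζ : (Fin d → ℝ) → ℝ) (hζ : MemLp ζ r μ) (ε : ℝ) (hε : 0 < ε) :
    (∃ (N : ℕ) (w : ParamIdx d N → ℝ), (∀ i, w (.inr (.inr i)) = 0) ∧
      ∀ (Ω : Type*) [MeasurableSpace Ω] (P : Measure Ω) [IsProbabilityMeasure P]
        (g : Ω → ParamIdx d N → Bool), IsDropconnectFilter P p g →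
        ApproxInProbAndLq μ r q ε P (fun ω => network σ (filtered w (g ω))) ζ) ∧
    (∃ (N : ℕ) (w : ParamIdx d N → ℝ), (∀ i, w (.inr (.inr i)) = 0) ∧
      ∀ (Ω : Type*) [MeasurableSpace Ω] (P : Measure Ω) [IsProbabilityMeasure P]
        (g : Ω → ParamIdx d N → Bool), IsNodeDropoutFilter P 0 p g →
        ApproxInProbAndLq μ r q ε P (fun ω => network σ (filtered w (g ω))) ζ) := by
  have : Fact (1 ≤ r) := ⟨hr⟩
  have hdense : ridgeSpan hσ_Lr = ⊤ :=
    ridgeSpan_eq_top hr_top hμ_ac hμ_compact Measure.support_mem_ae hσ_meas hσ_Lr hσ_poly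
  have hp' : 0 < 1 - p := by linarith
  constructor
  -- the patterns of the incoming weights have product probabilities
  · have hfac : ∀ (S : Fin d → Bool) (k : Fin d), 0 ≤ (if S k then 1 - p else p) ∧
        (if S k then 1 - p else p) ≤ 1 := by
      intro S k
      split_ifs <;> constructor <;> linarith
    obtain ⟨N, w, hw, h⟩ := exists_network_of_isNodewiseFilter hσ_Lr hdense
      (θ := fun S => (1 - p) * ∏ k, if S k then 1 - p else p)
      (fun S => mul_nonneg hp'.le (Finset.prod_nonneg fun k _ => (hfac S k).1))
      (fun S => mul_le_one₀ (by linarith) (Finset.prod_nonneg fun k _ => (hfac S k).1)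
        (Finset.prod_le_one (fun k _ => (hfac S k).1) fun k _ => (hfac S k).2))
      (by simp only [if_true]; positivity) hq hζ hε
    exact ⟨N, w, hw, fun Ω _ P _ g hg => h Ω P g (hg.isNodewiseFilter hp hp_lt.le)⟩
  · obtain ⟨N, w, hw, h⟩ := exists_network_of_isNodewiseFilter hσ_Lr hdense
      (θ := fun S => if S = fun _ => true then 1 - p else 0)
      (fun S => by split_ifs <;> linarith) (fun S => by split_ifs <;> linarith)
      (by simpa using hp_lt) hq hζ hε
    exact ⟨N, w, hw, fun Ω _ P _ g hg => h Ω P g hg.isNodewiseFilter⟩
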